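/- Let $n\ge 1$ be an integer and $0<p\le\infty$, with the convention $1/\infty=0$; if $n=1$, assume $p<\infty$. Let $\mu$ be the measure on $\mathbb{R}^n$ with a continuous density $g:\mathbb{R}^n\to[0,\infty)$ with respect to Lebesgue measure. Assume that $g$ is $p$-concave, that is, for all $x,y$ with $g(x),g(y)>0$ and all $\lambda\in(0,1)$, $$g(\lambda x+(1-\lambda)y)\ \ge\ \bigl(\lambda g(x)^p+(1-\lambda)g(y)^p\bigr)^{1/p}$$ (for $p=\infty$ the right-hand side is $\max\{g(x),g(y)\}$), and that $g$ is $\tfrac1p$-homogeneous, that is, $g(ax)=a^{1/p}g(x)$ for all $a>0$ and $x\in\mathbb{R}^n$. (For $p=\infty$ these densities are the non-negative constants.) For sets $A,B\subseteq\mathbb{R}^n$ put $\mu_1(A,B)=\liminf_{\delta\to0^+}\frac{\mu(A+\delta B)-\mu(A)}{\delta}$. For a convex body $K$ (a compact convex set with non-empty interior) and $\theta\in S^{n-1}$ put $$P_{\mu,K}(\theta)=\frac n2\int_0^1\mu_1(tK,[-\theta,\theta])\,dt .$$ For a compact set $L$ put $\mu_{n-1}(L\cap\theta^\perp)=\int_{L\cap\theta^\perp}g\,d\lambda_{n-1}$,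 where $\lambda_{n-1}$ is Lebesgue measure on the hyperplane $\theta^\perp$. A star body is a compact set $L\subset\mathbb{R}^n$ such that $[0,x)=\{tx:0\le t<1\}\subseteq\operatorname{int}(L)$ for every $x\in L\setminus\{0\}$. Let $B_2^n$ be the closed Euclidean unit ball, and let $\omega_k$ be the Lebesgue measure of $B_2^k$ ($\omega_0=1$). Let $K$ be an origin-symmetric convex body in $\mathbb{R}^n$, let $L$ be a star body in $\mathbb{R}^n$, and let $\varepsilon\in\mathbb{R}$ be such that $$P_{\mu,K}(\theta)\le\mu_{n-1}(L\cap\theta^\perp)+\varepsilon\qquad\text{for all }\theta\in S^{n-1}.$$ Then, with $q=\dfrac{1}{n+\frac1p}$, $$\mu(K)^{1-q}\ \le\ \left(\frac{1-\frac1n}{1-q}\right)\mu(L)^{1-q}+\frac{\omega_n}{\mu(B_2^n)^q\,\omega_{n-1}}\,\varepsilon ,$$ where, in the trivial case $\mu=0$, the last term is read as $0$. -/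

import Mathlib

open MeasureTheory Set Filter Topology
open scoped ENNReal Pointwise

noncomputable section

/-- A convex body in `ℝⁿ`: a compact convex set with non-empty interior. -/
structure IsConvexBody {n : ℕ} (K : Set (EuclideanSpace ℝ (Fin n))) : Prop where
  isCompact : IsCompact K
  convex : Convex ℝ K
  interior_nonempty : (interior K).Nonempty

/-- A set is origin-symmetric if `-K = K`. -/
def IsOriginSymmetric {n : ℕ} (K : Set (EuclideanSpace ℝ (Fin n))) : Prop :=
  -K = K

/-- A star body in `ℝⁿ`: a compact set `L` such that for every `x ∈ L` the half-open segment
`[0, x) = {t x : 0 ≤ t < 1}` (empty when `x = 0`) lies in the interior of `L`. -/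
structure IsStarBody {n : ℕ} (L : Set (EuclideanSpace ℝ (Fin n))) : Prop where
  isCompact : IsCompact L
  segment_subset : ∀ x ∈ L, x ≠ 0 → ∀ t : ℝ, 0 ≤ t → t < 1 → t • x ∈ interior L

/-- The mean of order `p ∈ (0, ∞]` of `a, b ≥ 0` with weights `s` and `1 - s`, `0 < s < 1`. It is
`(s a ^ p + (1 - s) b ^ p) ^ (1 / p)` for finite `p`, and `max a b` for `p = ∞`. -/
def powerMean (p : ℝ≥0∞) (s a b : ℝ) : ℝ :=
  if p = ⊤ then max a b
  else (s * a ^ p.toReal + (1 - s) * b ^ p.toReal) ^ (1 / p.toReal)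

/-- `p`-concavity, `p ∈ (0, ∞]`, of a non-negative function `f` on its support. The weights
`s = 0` and `s = 1` are left out because the inequality is then an equality (`p < ∞`). -/
def IsPConcave {n : ℕ} (p : ℝ≥0∞) (f : EuclideanSpace ℝ (Fin n) → ℝ) : Prop :=
  ∀ x ∈ Function.support f, ∀ y ∈ Function.support f, ∀ s : ℝ, 0 < s → s < 1 →
    powerMean p s (f x) (f y) ≤ f (s • x + (1 - s) • y)

/-- `r`-homogeneity: `f (a x) = a ^ r f x` for all `a > 0` and all `x`. -/
def IsHomogeneousOfDegree {n : ℕ} (r : ℝ) (f : EuclideanSpace ℝ (Fin n) → ℝ) : Prop :=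
  ∀ a : ℝ, 0 < a → ∀ x, f (a • x) = a ^ r * f x

/-- The mixed `μ`-measure
`μ₁(A, B) = liminf_{ε → 0+} (μ(A + ε B) - μ(A)) / ε`. -/
def mixedMeasure {n : ℕ} (μ : Measure (EuclideanSpace ℝ (Fin n)))
    (A B : Set (EuclideanSpace ℝ (Fin n))) : ℝ :=
  liminf (fun ε : ℝ => (μ.real (A + ε • B) - μ.real A) / ε) (𝓝[>] 0)

/-- The `μ`-projection
`P_{μ,K}(θ) = (n / 2) ∫₀¹ μ₁(tK, [-θ, θ]) dt`. -/
def muProjection {n : ℕ} (μ : Measure (EuclideanSpace ℝ (Fin n)))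
    (K : Set (EuclideanSpace ℝ (Fin n))) (θ : EuclideanSpace ℝ (Fin n)) : ℝ :=
  (n : ℝ) / 2 * ∫ t in (0 : ℝ)..1, mixedMeasure μ (t • K) (segment ℝ (-θ) θ)

/-- Lebesgue measure on a linear subspace of `ℝⁿ`, that is, the translation-invariant measure
which gives mass one to the unit cube of an orthonormal basis of the subspace. -/
def subspaceLebesgue {n : ℕ} (W : Submodule ℝ (EuclideanSpace ℝ (Fin n))) : Measure W :=
  (stdOrthonormalBasis ℝ W).toBasis.addHaar

/-- The measure of a central hyperplane section,
`μ_{n-1}(L ∩ θ^⊥) = ∫_{L ∩ θ^⊥} g dλ_{n-1}`, for the measure `μ` with continuous density `g`. -/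
def sectionMeasure {n : ℕ} (g : EuclideanSpace ℝ (Fin n) → ℝ)
    (L : Set (EuclideanSpace ℝ (Fin n))) (θ : EuclideanSpace ℝ (Fin n)) : ℝ :=
  ∫ x in {x : (Submodule.span ℝ {θ})ᗮ | (x : EuclideanSpace ℝ (Fin n)) ∈ L},
    g x ∂(subspaceLebesgue (Submodule.span ℝ {θ})ᗮ)

/-- The closed Euclidean unit ball `B₂ⁿ`. -/
def unitBall (n : ℕ) : Set (EuclideanSpace ℝ (Fin n)) :=
  Metric.closedBall 0 1

/-- `ω_n`, the Lebesgue measure of the unit ball of `ℝⁿ`. -/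
def ballVolume (n : ℕ) : ℝ :=
  volume.real (unitBall n)

end

/-! Write `r = 1/p` and `D = n + r`, so that `q = 1/D`; by homogeneity `μ(aA) = a^D μ(A)`. The
hypothesis is averaged over all directions `θ = U e`, with `U` a Haar-random rotation, and the two
averages are estimated separately.

Projection side. In polar coordinates `μ(K + εC)` is the integral over the fixed set `K` of `(‖x‖_K
/ ‖x‖_{K+εC})^D`. Differentiating under the integral at `ε = 0` gives the first variation `D ∫_K
h_C(∇‖x‖_K) dμ`, with `h_C` the support function of `C` (`tendsto_densityMeasure_add_smul_sub_div`).
For `C = [-θ, θ]` this yields `P_{μ,K}(θ) = (n/2) ∫_K |⟨∇‖x‖_K, θ⟩| dμ`, whose average over `θ` is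
`(ω_{n-1}/ω_n) ∫_K |∇‖x‖_K| dμ`. For `C` the unit ball the same formula, combined with a
Brunn-Minkowski inequality of exponent `1/D`, bounds that integral below by `μ(K)^{1-q} μ(B)^q`
(`rpow_mul_rpow_le_integral_norm_fderiv_gauge`). This Brunn-Minkowski inequality comes from
Prékopa-Leindler: a `p`-concave density is log-concave, and homogeneity upgrades the multiplicative
inequality to the additive one.

Section side. The average of `μ_{n-1}(L ∩ θ^⊥)` is a constant times `∫_L ‖x‖⁻¹ dμ`. Since `‖x‖⁻¹`
decreases radially, among sets of the same measure this integral is largest for a centred ball,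
where it is explicit (`setLIntegral_inv_norm_le`).

Comparing the two averages and dividing by `ω_{n-1} μ(B)^q / ω_n` gives the theorem. -/

/-! ### The Prékopa-Leindler inequality -/

/-- The one-dimensional Brunn-Minkowski inequality, with the Minkowski sum replaced by any set that
contains it. -/
theorem Real.volume_add_volume_le_of_add_subset {A B C : Set ℝ} (hA : MeasurableSet A)
    (hB : MeasurableSet B) (hA' : A.Nonempty) (hB' : B.Nonempty) (h : A + B ⊆ C) :
    volume A + volume B ≤ volume C := by
  have key : ∀ S ⊆ A, IsCompact S → ∀ T ⊆ B, IsCompact T →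
      S.Nonempty → T.Nonempty → volume S + volume T ≤ volume C := by
    intro S hSA hS T hTB hT hSn hTn
    obtain ⟨a, haS, ha⟩ := hS.exists_isGreatest hSn
    obtain ⟨b, hbT, hb⟩ := hT.exists_isLeast hTn
    -- With `a = max S` and `b = min T`, the translates `b + S` and `a + T` both lie in `S + T` and
    -- meet at most in the point `a + b`.
    have h1 : volume ((b +ᵥ S) ∪ (a +ᵥ T)) ≤ volume C := by
      refine measure_mono (union_subset ?_ ?_)
      · rintro _ ⟨x, hx, rfl⟩
        exact h ⟨x, hSA hx, b, hTB hbT, by simp [add_comm]⟩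
      · rintro _ ⟨y, hy, rfl⟩
        exact h ⟨a, hSA haS, y, hTB hy, by simp⟩
    refine le_trans (le_of_eq ?_) h1
    rw [measure_union₀, measure_vadd, measure_vadd]
    · exact ((hT.vadd a).measurableSet).nullMeasurableSet
    · refine measure_mono_null (t := {a + b}) ?_ (by simp)
      rintro _ ⟨⟨x, hx, rfl⟩, ⟨y, hy, hxy⟩⟩
      have h1 := ha hx
      have h2 := hb hy
      simp only [vadd_eq_add, mem_singleton_iff] at *
      linarith
  have key2 : ∀ S ⊆ A, IsCompact S → ∀ T ⊆ B, IsCompact T → volume S + volume T ≤ volume C := by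
    intro S hSA hS T hTB hT
    obtain ⟨a, ha⟩ := hA'
    obtain ⟨b, hb⟩ := hB'
    calc volume S + volume T ≤ volume (insert a S) + volume (insert b T) := by
          gcongr <;> exact subset_insert _ _
      _ ≤ volume C := key _ (insert_subset ha hSA) (hS.insert a) _ (insert_subset hb hTB)
          (hT.insert b) (insert_nonempty _ _) (insert_nonempty _ _)
  rw [hA.measure_eq_iSup_isCompact volume, hB.measure_eq_iSup_isCompact volume]
  refine ENNReal.biSup_add_biSup_le' (p := fun S => S ⊆ A) (q := fun S => S ⊆ B)
    (f := fun S => ⨆ (_ : IsCompact S), volume S) (g := fun S => ⨆ (_ : IsCompact S), volume S)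
    ⟨∅, empty_subset _⟩ ⟨∅, empty_subset _⟩ ?_
  intro S hS T hT
  by_cases h1 : IsCompact S <;> by_cases h2 : IsCompact T <;> simp only [h1, h2, iSup_true, iSup_false]
  · exact key2 S hS h1 T hT h2
  · simpa using key2 S hS h1 ∅ (empty_subset _) isCompact_empty
  · simpa using key2 ∅ (empty_subset _) isCompact_empty T hT h2
  · simp

theorem ENNReal.geom_mean_le_arith_mean2 {s t : ℝ} (hs : 0 < s) (ht : 0 < t) (hst : s + t = 1)
    (a b : ℝ≥0∞) : a ^ s * b ^ t ≤ ENNReal.ofReal s * a + ENNReal.ofReal t * b := by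
  rcases eq_or_ne a ⊤ with rfl | ha
  · simp [ENNReal.mul_top, hs]
  rcases eq_or_ne b ⊤ with rfl | hb
  · simp [ENNReal.mul_top, ht]
  have := Real.geom_mean_le_arith_mean2_weighted hs.le ht.le (ENNReal.toReal_nonneg (a := a))
    (ENNReal.toReal_nonneg (a := b)) hst
  rw [← ENNReal.ofReal_toReal ha, ← ENNReal.ofReal_toReal hb,
    ENNReal.ofReal_rpow_of_nonneg ENNReal.toReal_nonneg hs.le,
    ENNReal.ofReal_rpow_of_nonneg ENNReal.toReal_nonneg ht.le,
    ← ENNReal.ofReal_mul (by positivity), ← ENNReal.ofReal_mul hs.le, ← ENNReal.ofReal_mul ht.le,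
    ← ENNReal.ofReal_add (by positivity) (by positivity)]
  exact ENNReal.ofReal_le_ofReal this

theorem lintegral_eq_setLIntegral_Ioo_measure_lt {α : Type*} [MeasurableSpace α] (μ : Measure α)
    {f : α → ℝ≥0∞} (hf : Measurable f) (h1 : ∀ x, f x ≤ 1) :
    ∫⁻ x, f x ∂μ = ∫⁻ r in Ioo (0 : ℝ) 1, μ {x | ENNReal.ofReal r < f x} := by
  have hne : ∀ x, f x ≠ ⊤ := fun x => ((h1 x).trans_lt ENNReal.one_lt_top).ne
  have e1 : ∫⁻ x, f x ∂μ = ∫⁻ x, ENNReal.ofReal (f x).toReal ∂μ := by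
    simp only [ENNReal.ofReal_toReal (hne _)]
  rw [e1, lintegral_eq_lintegral_meas_lt μ (Eventually.of_forall fun x => ENNReal.toReal_nonneg)
    hf.ennreal_toReal.aemeasurable, ← Ioo_union_Ici_eq_Ioi (zero_lt_one (α := ℝ)),
    lintegral_union measurableSet_Ici (Set.disjoint_left.2 fun x hx hx' => not_le.2 hx.2 hx')]
  have e2 : ∫⁻ r in Ici (1 : ℝ), μ {x | r < (f x).toReal} = 0 := by
    rw [setLIntegral_congr_fun (g := fun _ => 0) measurableSet_Ici]
    · simp
    · intro r hr
      have : {x | r < (f x).toReal} = ∅ := by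
        ext x
        have : (f x).toReal ≤ 1 := ENNReal.toReal_le_of_le_ofReal zero_le_one (by simpa using h1 x)
        simpa using this.trans hr
      simp [this]
  rw [e2, add_zero]
  refine setLIntegral_congr_fun measurableSet_Ioo fun r hr => ?_
  simp only [ENNReal.ofReal_lt_iff_lt_toReal hr.1.le (hne _)]

/-- Equal suprema make the superlevel sets of `f` and `g` nonempty for exactly the same levels `r <
1`, and `s{f > r} + t{g > r} ⊆ {h > r}`. One-dimensional Brunn-Minkowski at each level, integrated
over `r`, gives even the arithmetic mean of the two integrals as a lower bound. -/
theorem prekopa_leindler_real_of_iSup_eq_one {s t : ℝ} (hs : 0 < s) (ht : 0 < t) (hst : s + t = 1)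
    {f g h : ℝ → ℝ≥0∞} (hf : Measurable f) (hg : Measurable g) (hh : Measurable h)
    (hf1 : ⨆ x, f x = 1) (hg1 : ⨆ x, g x = 1)
    (H : ∀ x y, f x ^ s * g y ^ t ≤ h (s * x + t * y)) :
    (∫⁻ x, f x) ^ s * (∫⁻ x, g x) ^ t ≤ ∫⁻ x, h x := by
  refine (ENNReal.geom_mean_le_arith_mean2 hs ht hst _ _).trans ?_
  have hf' : ∀ x, f x ≤ 1 := fun x => hf1 ▸ le_iSup f x
  have hg' : ∀ x, g x ≤ 1 := fun x => hg1 ▸ le_iSup g x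
  calc (ENNReal.ofReal s * ∫⁻ x, f x) + ENNReal.ofReal t * ∫⁻ x, g x
      ≤ ∫⁻ x, min (h x) 1 := ?_
    _ ≤ ∫⁻ x, h x := lintegral_mono fun x => min_le_left _ _
  have anti : ∀ u : ℝ → ℝ≥0∞, Measurable fun r : ℝ => volume {x | ENNReal.ofReal r < u x} := by
    intro u
    refine Antitone.measurable fun a b hab => measure_mono fun x hx => ?_
    exact (ENNReal.ofReal_le_ofReal hab).trans_lt hx
  rw [lintegral_eq_setLIntegral_Ioo_measure_lt _ hf hf',
    lintegral_eq_setLIntegral_Ioo_measure_lt _ hg hg',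
    lintegral_eq_setLIntegral_Ioo_measure_lt _ (hh.min measurable_const) (fun x => min_le_right _ _),
    ← lintegral_const_mul _ (anti f), ← lintegral_const_mul _ (anti g),
    ← lintegral_add_left ((anti f).const_mul _)]
  refine setLIntegral_mono (anti _) fun r hr => ?_
  have hr1 : ENNReal.ofReal r < 1 := by simpa using hr.2
  obtain ⟨x0, hx0⟩ := lt_iSup_iff.1 (hf1 ▸ hr1)
  obtain ⟨y0, hy0⟩ := lt_iSup_iff.1 (hg1 ▸ hr1)
  have e : ∀ (c : ℝ) (u : ℝ → ℝ≥0∞), 0 < c → ENNReal.ofReal c * volume {x | ENNReal.ofReal r < u x} =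
      volume (c • {x | ENNReal.ofReal r < u x}) := by
    intro c u hc
    rw [Measure.addHaar_smul]
    simp [abs_of_pos hc]
  rw [e s f hs, e t g ht]
  refine Real.volume_add_volume_le_of_add_subset
    ((measurableSet_lt measurable_const hf).const_smul_of_ne_zero hs.ne')
    ((measurableSet_lt measurable_const hg).const_smul_of_ne_zero ht.ne')
    (Set.Nonempty.smul_set ⟨x0, hx0⟩) (Set.Nonempty.smul_set ⟨y0, hy0⟩) ?_
  rintro _ ⟨_, ⟨x, hx, rfl⟩, _, ⟨y, hy, rfl⟩, rfl⟩
  refine lt_min (lt_of_lt_of_le ?_ (H x y)) hr1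
  calc ENNReal.ofReal r = ENNReal.ofReal r ^ s * ENNReal.ofReal r ^ t := by
        rw [← ENNReal.rpow_add _ _ (by simpa using hr.1) ENNReal.ofReal_ne_top, hst, ENNReal.rpow_one]
    _ < f x ^ s * g y ^ t :=
        ENNReal.mul_lt_mul (ENNReal.rpow_lt_rpow hx hs) (ENNReal.rpow_lt_rpow hy ht)

/-- Hypothesis and conclusion are unchanged when `f`, `g`, `h` are divided by `a`, `b`, `a ^ s * b ^
t`, so both suprema may be normalized to one. -/
theorem prekopa_leindler_real_of_bounded {s t : ℝ} (hs : 0 < s) (ht : 0 < t) (hst : s + t = 1)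
    {f g h : ℝ → ℝ≥0∞} (hf : Measurable f) (hg : Measurable g) (hh : Measurable h)
    (hf1 : ⨆ x, f x ≠ ⊤) (hg1 : ⨆ x, g x ≠ ⊤)
    (H : ∀ x y, f x ^ s * g y ^ t ≤ h (s * x + t * y)) :
    (∫⁻ x, f x) ^ s * (∫⁻ x, g x) ^ t ≤ ∫⁻ x, h x := by
  set a := ⨆ x, f x with ha
  set b := ⨆ x, g x with hb
  rcases eq_or_ne a 0 with ha0 | ha0
  · have : ∀ x, f x = 0 := fun x => le_antisymm (ha0 ▸ le_iSup f x) zero_le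
    simp [this, hs]
  rcases eq_or_ne b 0 with hb0 | hb0
  · have : ∀ x, g x = 0 := fun x => le_antisymm (hb0 ▸ le_iSup g x) zero_le
    simp [this, ht]
  set c := a ^ s * b ^ t with hc
  have hc0 : c ≠ 0 := by simp [hc, ha0, hb0, hf1, hg1]
  have hct : c ≠ ⊤ := ENNReal.mul_ne_top (by simp [ha0, hf1]) (by simp [hb0, hg1])
  have key := prekopa_leindler_real_of_iSup_eq_one hs ht hst (hf.const_mul a⁻¹) (hg.const_mul b⁻¹)
    (hh.const_mul c⁻¹) (by rw [← ENNReal.mul_iSup, ENNReal.inv_mul_cancel ha0 hf1])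
    (by rw [← ENNReal.mul_iSup, ENNReal.inv_mul_cancel hb0 hg1]) (fun x y => by
      have : (a⁻¹ * f x) ^ s * (b⁻¹ * g y) ^ t = c⁻¹ * (f x ^ s * g y ^ t) := by
        rw [ENNReal.mul_rpow_of_nonneg _ _ hs.le, ENNReal.mul_rpow_of_nonneg _ _ ht.le, hc,
          ENNReal.mul_inv (by simp [ha0, hf1]) (by simp [hf1, ha0]), ENNReal.inv_rpow,
          ENNReal.inv_rpow]
        ring
      rw [this]
      gcongr
      exact H x y)
  rw [lintegral_const_mul _ hf, lintegral_const_mul _ hg, lintegral_const_mul _ hh,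
    ENNReal.mul_rpow_of_nonneg _ _ hs.le, ENNReal.mul_rpow_of_nonneg _ _ ht.le] at key
  have e : c * (a⁻¹ ^ s * (∫⁻ x, f x) ^ s * (b⁻¹ ^ t * (∫⁻ x, g x) ^ t)) =
      (∫⁻ x, f x) ^ s * (∫⁻ x, g x) ^ t := by
    have : c * (a⁻¹ ^ s * b⁻¹ ^ t) = 1 := by
      rw [ENNReal.inv_rpow, ENNReal.inv_rpow, ← ENNReal.mul_inv (by simp [ha0, hf1])
        (by simp [hf1, ha0]), ENNReal.mul_inv_cancel hc0 hct]
    calc _ = c * (a⁻¹ ^ s * b⁻¹ ^ t) * ((∫⁻ x, f x) ^ s * (∫⁻ x, g x) ^ t) := by ring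
      _ = _ := by rw [this, one_mul]
  have e2 : c * (c⁻¹ * ∫⁻ x, h x) = ∫⁻ x, h x := by
    rw [← mul_assoc, ENNReal.mul_inv_cancel hc0 hct, one_mul]
  rw [← e, ← e2]
  gcongr

theorem lintegral_min_natCast_tendsto {α : Type*} [MeasurableSpace α] (μ : Measure α)
    {f : α → ℝ≥0∞} (hf : Measurable f) :
    Tendsto (fun k : ℕ => ∫⁻ x, min (f x) k ∂μ) atTop (𝓝 (∫⁻ x, f x ∂μ)) := by
  refine lintegral_tendsto_of_tendsto_of_monotone (fun k => (hf.min measurable_const).aemeasurable)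
    (Eventually.of_forall fun x k l hkl => min_le_min le_rfl (by exact_mod_cast hkl))
    (Eventually.of_forall fun x => ?_)
  have : Tendsto (fun k : ℕ => min (f x) (k : ℝ≥0∞)) atTop (𝓝 (min (f x) ⊤)) :=
    tendsto_const_nhds.min ENNReal.tendsto_nat_nhds_top
  simpa using this

/-- The Prékopa-Leindler inequality on the line. -/
theorem prekopa_leindler_real {s t : ℝ} (hs : 0 < s) (ht : 0 < t) (hst : s + t = 1)
    {f g h : ℝ → ℝ≥0∞} (hf : Measurable f) (hg : Measurable g) (hh : Measurable h)
    (H : ∀ x y, f x ^ s * g y ^ t ≤ h (s * x + t * y)) :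
    (∫⁻ x, f x) ^ s * (∫⁻ x, g x) ^ t ≤ ∫⁻ x, h x := by
  rcases eq_or_ne (∫⁻ x, f x) 0 with hf0 | hf0
  · simp [hf0, hs]
  rcases eq_or_ne (∫⁻ x, g x) 0 with hg0 | hg0
  · simp [hg0, ht]
  -- Multiplication on `ℝ≥0∞` is discontinuous at `0 * ⊤`; the vanishing integrals were split off
  -- above to avoid that case.
  have hlim : Tendsto (fun k : ℕ => (∫⁻ x, min (f x) k) ^ s * (∫⁻ x, min (g x) k) ^ t) atTop
      (𝓝 ((∫⁻ x, f x) ^ s * (∫⁻ x, g x) ^ t)) :=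
    ENNReal.Tendsto.mul
      ((ENNReal.continuous_rpow_const.tendsto _).comp (lintegral_min_natCast_tendsto _ hf))
      (Or.inl (by simp [hf0, hs, not_lt.2 hs.le]))
      ((ENNReal.continuous_rpow_const.tendsto _).comp (lintegral_min_natCast_tendsto _ hg))
      (Or.inl (by simp [hg0, ht, not_lt.2 ht.le]))
  refine le_of_tendsto' hlim fun k => ?_
  refine prekopa_leindler_real_of_bounded hs ht hst (hf.min measurable_const)
    (hg.min measurable_const) hh ?_ ?_ fun x y => le_trans ?_ (H x y)
  · exact ((iSup_le fun x => min_le_right _ _).trans_lt (ENNReal.natCast_lt_top k)).ne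
  · exact ((iSup_le fun x => min_le_right _ _).trans_lt (ENNReal.natCast_lt_top k)).ne
  · gcongr <;> exact min_le_left _ _

/-- The Prékopa-Leindler inequality on `ℝⁿ`. -/
theorem prekopa_leindler_pi {s t : ℝ} (hs : 0 < s) (ht : 0 < t) (hst : s + t = 1) (n : ℕ) :
    ∀ {f g h : (Fin n → ℝ) → ℝ≥0∞}, Measurable f → Measurable g → Measurable h →
    (∀ x y, f x ^ s * g y ^ t ≤ h (s • x + t • y)) →
    (∫⁻ x, f x) ^ s * (∫⁻ x, g x) ^ t ≤ ∫⁻ x, h x := by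
  induction n with
  | zero =>
    intro f g h hf hg hh H
    have e : ∀ u : (Fin 0 → ℝ) → ℝ≥0∞, ∫⁻ x, u x = u 0 := by
      intro u
      rw [volume_pi, Measure.pi_of_empty _ 0, lintegral_dirac]
    rw [e, e, e]
    simpa using H 0 0
  | succ n ih =>
    intro f g h hf hg hh H
    let m := (MeasurableEquiv.piFinSuccAbove (fun _ : Fin (n + 1) => ℝ) 0).symm
    have hm : MeasurePreserving m volume volume :=
      (volume_preserving_piFinSuccAbove (fun _ : Fin (n + 1) => ℝ) 0).symm
    have hadd : ∀ (x y : ℝ) (x' y' : Fin n → ℝ),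
        m (s * x + t * y, s • x' + t • y') = s • m (x, x') + t • m (y, y') := by
      intro x y x' y'
      ext i
      refine Fin.cases ?_ (fun i => ?_) i <;> simp [m, MeasurableEquiv.piFinSuccAbove]
    have e : ∀ {u : (Fin (n + 1) → ℝ) → ℝ≥0∞}, Measurable u →
        ∫⁻ x, u x = ∫⁻ x : ℝ, ∫⁻ x' : Fin n → ℝ, u (m (x, x')) := by
      intro u hu
      rw [← hm.lintegral_comp hu, Measure.volume_eq_prod]
      exact lintegral_prod _ (hu.comp m.measurable).aemeasurable
    have meas : ∀ {u : (Fin (n + 1) → ℝ) → ℝ≥0∞}, Measurable u →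
        Measurable fun x : ℝ => ∫⁻ x' : Fin n → ℝ, u (m (x, x')) := fun hu =>
      Measurable.lintegral_prod_right (hu.comp m.measurable)
    have msec : ∀ {u : (Fin (n + 1) → ℝ) → ℝ≥0∞}, Measurable u → ∀ x : ℝ,
        Measurable fun x' : Fin n → ℝ => u (m (x, x')) := fun hu x =>
      (hu.comp m.measurable).comp measurable_prodMk_left
    rw [e hf, e hg, e hh]
    -- The induction hypothesis on the slices over `x`, `y` and `s * x + t * y` is precisely the
    -- one-dimensional hypothesis for the marginals.
    refine prekopa_leindler_real hs ht hst (meas hf) (meas hg) (meas hh) fun x y => ?_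
    refine ih (msec hf x) (msec hg y) (msec hh _) fun x' y' => ?_
    rw [hadd]
    exact H _ _

theorem prekopa_leindler {n : ℕ} {s t : ℝ} (hs : 0 < s) (ht : 0 < t) (hst : s + t = 1)
    {f g h : EuclideanSpace ℝ (Fin n) → ℝ≥0∞} (hf : Measurable f) (hg : Measurable g)
    (hh : Measurable h) (H : ∀ x y, f x ^ s * g y ^ t ≤ h (s • x + t • y)) :
    (∫⁻ x, f x) ^ s * (∫⁻ x, g x) ^ t ≤ ∫⁻ x, h x := by
  have hp := PiLp.volume_preserving_toLp (Fin n)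
  rw [← hp.lintegral_comp hf, ← hp.lintegral_comp hg, ← hp.lintegral_comp hh]
  refine prekopa_leindler_pi hs ht hst n (hf.comp hp.measurable) (hg.comp hp.measurable)
    (hh.comp hp.measurable) fun x y => ?_
  simpa using H (WithLp.toLp 2 x) (WithLp.toLp 2 y)

/-! ### Polar coordinates and measures with homogeneous density -/

/-- Integration in polar coordinates. -/
theorem lintegral_eq_lintegral_toSphere {E : Type*} [NormedAddCommGroup E] [NormedSpace ℝ E]
    [MeasurableSpace E] [BorelSpace E] [FiniteDimensional ℝ E] [Nontrivial E] (μ : Measure E)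
    [μ.IsAddHaarMeasure] {f : E → ℝ≥0∞} (hf : Measurable f) :
    ∫⁻ x, f x ∂μ = ∫⁻ θ : Metric.sphere (0 : E) 1, (∫⁻ s in Ioi (0 : ℝ),
      ENNReal.ofReal (s ^ (Module.finrank ℝ E - 1)) * f (s • (θ : E))) ∂μ.toSphere := by
  have hmp := μ.measurePreserving_homeomorphUnitSphereProd
  have hemb := (homeomorphUnitSphereProd E).measurableEmbedding
  have hF : Measurable fun z : Metric.sphere (0 : E) 1 × Ioi (0 : ℝ) => f ((z.2 : ℝ) • (z.1 : E)) :=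
    hf.comp (by fun_prop)
  calc ∫⁻ x, f x ∂μ = ∫⁻ x in ({0}ᶜ : Set E), f x ∂μ := by
        rw [restrict_compl_singleton]
    _ = ∫⁻ x : ({0}ᶜ : Set E), f x ∂(μ.comap (↑)) :=
        (lintegral_subtype_comap (measurableSet_singleton _).compl f).symm
    _ = ∫⁻ z, f ((z.2 : ℝ) • (z.1 : E))
          ∂(μ.toSphere.prod (Measure.volumeIoiPow (Module.finrank ℝ E - 1))) := by
        rw [← hmp.lintegral_comp_emb hemb]
        refine lintegral_congr fun x => ?_
        rw [← homeomorphUnitSphereProd_symm_apply_coe, Homeomorph.symm_apply_apply]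
    _ = _ := by
        rw [lintegral_prod _ hF.aemeasurable]
        refine lintegral_congr fun θ => ?_
        rw [Measure.volumeIoiPow, lintegral_withDensity_eq_lintegral_mul _ (by fun_prop)
          (show Measurable fun s : Ioi (0 : ℝ) => f ((s : ℝ) • (θ : E)) from
            hF.comp measurable_prodMk_left)]
        exact lintegral_subtype_comap measurableSet_Ioi
          (fun s : ℝ => ENNReal.ofReal (s ^ (Module.finrank ℝ E - 1)) * f (s • (θ : E)))

theorem setLIntegral_Ioc_rpow {D b : ℝ} (hD : 0 < D) (hb : 0 ≤ b) :
    ∫⁻ s in Ioc 0 b, ENNReal.ofReal (s ^ (D - 1)) = ENNReal.ofReal (b ^ D / D) := by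
  rw [← ofReal_integral_eq_lintegral_ofReal]
  · rw [← intervalIntegral.integral_of_le hb, integral_rpow (Or.inl (by linarith))]
    simp [Real.zero_rpow hD.ne']
  · exact (intervalIntegral.intervalIntegrable_rpow' (by linarith)).1
  · filter_upwards [ae_restrict_mem measurableSet_Ioc] with s hs
    exact Real.rpow_nonneg hs.1.le _

/-- The measure on `ℝⁿ` with density `g` with respect to Lebesgue measure. -/
noncomputable def densityMeasure {n : ℕ} (g : EuclideanSpace ℝ (Fin n) → ℝ) :
    Measure (EuclideanSpace ℝ (Fin n)) :=
  volume.withDensity fun x => ENNReal.ofReal (g x)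

section DensityMeasure

variable {n : ℕ} {g : EuclideanSpace ℝ (Fin n) → ℝ} {r : ℝ}

theorem isLocallyFiniteMeasure_densityMeasure (hg : Continuous g) :
    IsLocallyFiniteMeasure (densityMeasure g) :=
  IsLocallyFiniteMeasure.withDensity_ofReal hg

theorem densityMeasure_lt_top (hg : Continuous g) {A : Set (EuclideanSpace ℝ (Fin n))}
    (hA : IsCompact A) : densityMeasure g A < ⊤ :=
  have := isLocallyFiniteMeasure_densityMeasure hg
  hA.measure_lt_top

theorem densityMeasure_apply (A : Set (EuclideanSpace ℝ (Fin n))) :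
    densityMeasure g A = ∫⁻ x in A, ENNReal.ofReal (g x) :=
  withDensity_apply' _ A

theorem setLIntegral_densityMeasure (hg : Continuous g) {u : EuclideanSpace ℝ (Fin n) → ℝ≥0∞}
    (hu : Measurable u) {A : Set (EuclideanSpace ℝ (Fin n))} (hA : MeasurableSet A) :
    ∫⁻ x in A, u x ∂(densityMeasure g) = ∫⁻ x in A, ENNReal.ofReal (g x) * u x := by
  rw [densityMeasure, setLIntegral_withDensity_eq_setLIntegral_mul _ (by fun_prop) hu hA]
  rfl

/-- The Jacobian contributes `a ^ n` and the density `a ^ r`. -/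
theorem densityMeasure_smul (hg : Continuous g) (hhom : IsHomogeneousOfDegree r g) {a : ℝ}
    (ha : 0 < a) {A : Set (EuclideanSpace ℝ (Fin n))} (hA : MeasurableSet A) :
    densityMeasure g (a • A) = ENNReal.ofReal (a ^ (n + r)) * densityMeasure g A := by
  have hmA : MeasurableSet (a • A) := hA.const_smul_of_ne_zero ha.ne'
  have hemb := (Homeomorph.smulOfNeZero (α := EuclideanSpace ℝ (Fin n)) a ha.ne').measurableEmbedding
  have key := hemb.lintegral_map (μ := volume)
    ((a • A).indicator fun x => ENNReal.ofReal (g x))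
  simp only [Homeomorph.smulOfNeZero_apply] at key
  rw [Measure.map_addHaar_smul _ ha.ne', lintegral_smul_measure, lintegral_indicator hmA,
    ← densityMeasure_apply] at key
  have e2 : ∀ x, (a • A).indicator (fun x => ENNReal.ofReal (g x)) (a • x) =
      ENNReal.ofReal (a ^ r) * A.indicator (fun x => ENNReal.ofReal (g x)) x := by
    intro x
    by_cases hx : x ∈ A
    · rw [indicator_of_mem (smul_mem_smul_set hx), indicator_of_mem hx, hhom a ha,
        ENNReal.ofReal_mul (by positivity)]
    · rw [indicator_of_notMem (by rwa [smul_mem_smul_set_iff₀ ha.ne']), indicator_of_notMem hx,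
        mul_zero]
  simp only [e2] at key
  rw [lintegral_const_mul _ (Measurable.indicator (by fun_prop) hA), lintegral_indicator hA,
    ← densityMeasure_apply, finrank_euclideanSpace, Fintype.card_fin, abs_of_pos (by positivity)]
    at key
  rw [Real.rpow_add ha, Real.rpow_natCast, ENNReal.ofReal_mul (by positivity), mul_assoc, ← key,
    smul_eq_mul, ← mul_assoc, ← ENNReal.ofReal_mul (by positivity), mul_inv_cancel₀ (by positivity)]
  simp

/-- The ray through `θ` meets the set in `0 < s ≤ (ψ θ)⁻¹`, where the integrand is `s ^ (n + r - 1)`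
times its value at `θ`. -/
theorem setLIntegral_densityMeasure_eq_lintegral_toSphere (hn : 1 ≤ n) (hg : Continuous g)
    (hhom : IsHomogeneousOfDegree r g) (hr : 0 < n + r)
    {ψ : EuclideanSpace ℝ (Fin n) → ℝ} (hψ : Measurable ψ)
    (hψhom : ∀ a : ℝ, 0 < a → ∀ x, ψ (a • x) = a * ψ x) (hψpos : ∀ x, x ≠ 0 → 0 < ψ x)
    {u : EuclideanSpace ℝ (Fin n) → ℝ≥0∞} (hu : Measurable u)
    (huhom : ∀ a : ℝ, 0 < a → ∀ x, u (a • x) = u x) :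
    ∫⁻ x in {x | ψ x ≤ 1}, u x ∂(densityMeasure g) =
      ∫⁻ θ : Metric.sphere (0 : EuclideanSpace ℝ (Fin n)) 1, ENNReal.ofReal (g θ) * u θ *
        ENNReal.ofReal ((ψ θ)⁻¹ ^ (n + r) / (n + r)) ∂volume.toSphere := by
  have : NeZero n := ⟨by lia⟩
  have : Nontrivial (EuclideanSpace ℝ (Fin n)) := by
    apply Module.nontrivial_of_finrank_pos (R := ℝ)
    simp; lia
  have hms : MeasurableSet {x | ψ x ≤ 1} := measurableSet_le hψ measurable_const
  rw [setLIntegral_densityMeasure hg hu hms, ← lintegral_indicator hms,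
    lintegral_eq_lintegral_toSphere _ (Measurable.indicator (by fun_prop) hms)]
  refine lintegral_congr fun θ => ?_
  have hθ : (θ : EuclideanSpace ℝ (Fin n)) ≠ 0 := by
    have := θ.2
    intro h
    simp [h] at this
  have hψθ := hψpos _ hθ
  rw [← setLIntegral_Ioc_rpow hr (by positivity), ← lintegral_const_mul _ (by fun_prop),
    ← lintegral_indicator measurableSet_Ioc, ← lintegral_indicator measurableSet_Ioi]
  refine lintegral_congr fun s => ?_
  by_cases hs : 0 < s
  swap
  · rw [indicator_of_notMem (by simpa using hs), indicator_of_notMem (by simp [hs])]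
  rw [indicator_of_mem (by simpa using hs)]
  have hiff : s • (θ : EuclideanSpace ℝ (Fin n)) ∈ {x | ψ x ≤ 1} ↔ s ∈ Ioc 0 (ψ θ)⁻¹ := by
    rw [mem_ofPred_eq, hψhom s hs, mem_Ioc, ← one_div, le_div_iff₀ hψθ]
    simp [hs]
  by_cases hs' : s ∈ Ioc 0 (ψ θ)⁻¹
  · rw [indicator_of_mem hs', indicator_of_mem (hiff.2 hs'), hhom s hs, huhom s hs,
      finrank_euclideanSpace, Fintype.card_fin, ENNReal.ofReal_mul (by positivity)]
    have e : s ^ (n + r - 1) = s ^ (n - 1) * s ^ r := by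
      rw [← Real.rpow_natCast, ← Real.rpow_add hs, Nat.cast_sub hn]
      congr 1
      push_cast
      ring
    rw [e, ENNReal.ofReal_mul (by positivity)]
    ring
  · rw [indicator_of_notMem hs', indicator_of_notMem (by rwa [hiff]), mul_zero]

/-- The measure of a star-shaped set as an integral over another star-shaped set. -/
theorem densityMeasure_eq_setLIntegral (hn : 1 ≤ n) (hg : Continuous g)
    (hhom : IsHomogeneousOfDegree r g) (hr : 0 < n + r)
    {φ ψ : EuclideanSpace ℝ (Fin n) → ℝ} (hφ : Measurable φ) (hψ : Measurable ψ)
    (hφhom : ∀ a : ℝ, 0 < a → ∀ x, φ (a • x) = a * φ x) (hφpos : ∀ x, x ≠ 0 → 0 < φ x)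
    (hψhom : ∀ a : ℝ, 0 < a → ∀ x, ψ (a • x) = a * ψ x) (hψpos : ∀ x, x ≠ 0 → 0 < ψ x) :
    densityMeasure g {x | ψ x ≤ 1} =
      ∫⁻ x in {x | φ x ≤ 1}, ENNReal.ofReal ((φ x / ψ x) ^ (n + r)) ∂(densityMeasure g) := by
  -- The integrand `φ / ψ` is constant on rays, so both sides become sphere integrals; the factor
  -- `(φ θ) ^ (n + r)` cancels the radial integral over `{φ ≤ 1}`.
  rw [setLIntegral_densityMeasure_eq_lintegral_toSphere hn hg hhom hr hφ hφhom hφpos (by fun_prop)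
    (fun a ha x => by rw [hφhom a ha, hψhom a ha, mul_div_mul_left _ _ ha.ne']),
    ← setLIntegral_one, setLIntegral_densityMeasure_eq_lintegral_toSphere hn hg hhom hr hψ hψhom
    hψpos measurable_const (fun _ _ _ => rfl)]
  refine lintegral_congr fun θ => ?_
  have hθ : (θ : EuclideanSpace ℝ (Fin n)) ≠ 0 := by
    have := θ.2
    intro h
    simp [h] at this
  have h1 := hψpos _ hθ
  have h2 := hφpos _ hθ
  rw [mul_one, mul_assoc, ← ENNReal.ofReal_mul (Real.rpow_nonneg (by positivity) _)]
  congr 2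
  rw [← mul_div_assoc, ← Real.mul_rpow (by positivity) (by positivity)]
  congr 2
  field_simp

/-- A power mean of positive order dominates the geometric mean. If `g` vanishes at `x` or `y` the
left side is zero, so log-concavity holds on all of `ℝⁿ` and not only on the support. -/
theorem IsPConcave.geom_mean_le {p : ℝ≥0∞} (hp : 0 < p) (hconc : IsPConcave p g)
    (hnonneg : ∀ x, 0 ≤ g x) {s t : ℝ} (hs : 0 < s) (ht : 0 < t) (hst : s + t = 1)
    (x y : EuclideanSpace ℝ (Fin n)) : g x ^ s * g y ^ t ≤ g (s • x + t • y) := by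
  rcases eq_or_ne (g x) 0 with hx | hx
  · rw [hx, Real.zero_rpow hs.ne', zero_mul]
    exact hnonneg _
  rcases eq_or_ne (g y) 0 with hy | hy
  · rw [hy, Real.zero_rpow ht.ne', mul_zero]
    exact hnonneg _
  have hx' := (hnonneg x).lt_of_ne' hx
  have hy' := (hnonneg y).lt_of_ne' hy
  obtain rfl : t = 1 - s := by linarith
  refine le_trans ?_ (hconc x hx y hy s hs (by linarith))
  rw [powerMean]
  split_ifs with h
  · refine (Real.geom_mean_le_arith_mean2_weighted hs.le ht.le hx'.le hy'.le hst).trans ?_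
    have h1 := mul_le_mul_of_nonneg_left (le_max_left (g x) (g y)) hs.le
    have h2 := mul_le_mul_of_nonneg_left (le_max_right (g x) (g y)) ht.le
    linarith
  · have hp' : 0 < p.toReal := ENNReal.toReal_pos hp.ne' h
    have := Real.geom_mean_le_arith_mean2_weighted hs.le ht.le (Real.rpow_nonneg hx'.le p.toReal)
      (Real.rpow_nonneg hy'.le p.toReal) hst
    refine le_trans (le_of_eq ?_) (Real.rpow_le_rpow (by positivity) this
      (one_div_nonneg.2 hp'.le))
    rw [Real.mul_rpow (by positivity) (by positivity), ← Real.rpow_mul (by positivity),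
      ← Real.rpow_mul (by positivity), ← Real.rpow_mul (by positivity),
      ← Real.rpow_mul (by positivity)]
    congr 2 <;> field_simp

/-- Prékopa-Leindler for the density cut off to `A`, to `B` and to `s • A + t • B`. -/
theorem densityMeasure_rpow_mul_rpow_le (hg : Continuous g) (hnonneg : ∀ x, 0 ≤ g x)
    {s t : ℝ} (hs : 0 < s) (ht : 0 < t) (hst : s + t = 1)
    (hlog : ∀ x y, g x ^ s * g y ^ t ≤ g (s • x + t • y))
    {A B : Set (EuclideanSpace ℝ (Fin n))} (hA : IsCompact A) (hB : IsCompact B) :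
    densityMeasure g A ^ s * densityMeasure g B ^ t ≤ densityMeasure g (s • A + t • B) := by
  have hC : MeasurableSet (s • A + t • B) := ((hA.smul s).add (hB.smul t)).measurableSet
  simp only [densityMeasure_apply]
  rw [← lintegral_indicator hA.measurableSet, ← lintegral_indicator hB.measurableSet,
    ← lintegral_indicator hC]
  have hm : Measurable fun x => ENNReal.ofReal (g x) := by fun_prop
  refine prekopa_leindler hs ht hst (hm.indicator hA.measurableSet) (hm.indicator hB.measurableSet)
    (hm.indicator hC) fun x y => ?_
  by_cases hx : x ∈ A
  swap
  · simp [hx, hs]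
  by_cases hy : y ∈ B
  swap
  · simp [hy, ht]
  rw [indicator_of_mem hx, indicator_of_mem hy, indicator_of_mem
    (Set.add_mem_add (smul_mem_smul_set hx) (smul_mem_smul_set hy)),
    ENNReal.ofReal_rpow_of_nonneg (hnonneg x) hs.le,
    ENNReal.ofReal_rpow_of_nonneg (hnonneg y) ht.le,
    ← ENNReal.ofReal_mul (Real.rpow_nonneg (hnonneg x) _)]
  exact ENNReal.ofReal_le_ofReal (hlog x y)

/-- The Brunn-Minkowski inequality for measures with a homogeneous log-concave density. -/
theorem densityMeasure_rpow_add_rpow_le (hg : Continuous g) (hnonneg : ∀ x, 0 ≤ g x)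
    (hhom : IsHomogeneousOfDegree r g) (hr : 0 < n + r)
    (hlog : ∀ s t : ℝ, 0 < s → 0 < t → s + t = 1 → ∀ x y, g x ^ s * g y ^ t ≤ g (s • x + t • y))
    {A B : Set (EuclideanSpace ℝ (Fin n))} (hA : IsCompact A) (hB : IsCompact B)
    (hA0 : 0 < (densityMeasure g).real A) (hB0 : 0 < (densityMeasure g).real B) :
    (densityMeasure g).real A ^ (n + r)⁻¹ + (densityMeasure g).real B ^ (n + r)⁻¹ ≤
      (densityMeasure g).real (A + B) ^ (n + r)⁻¹ := by
  set a := (densityMeasure g).real A ^ (n + r)⁻¹ with ha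
  set b := (densityMeasure g).real B ^ (n + r)⁻¹ with hb
  have ha0 : 0 < a := by positivity
  have hb0 : 0 < b := by positivity
  have hreal : ∀ {c : ℝ}, 0 < c → ∀ {S : Set (EuclideanSpace ℝ (Fin n))}, IsCompact S →
      (densityMeasure g).real (c • S) = c ^ (n + r) * (densityMeasure g).real S := by
    intro c hc S hS
    rw [measureReal_def, densityMeasure_smul hg hhom hc hS.measurableSet, ENNReal.toReal_mul,
      ENNReal.toReal_ofReal (by positivity), measureReal_def]
  have hone : ∀ {S : Set (EuclideanSpace ℝ (Fin n))}, IsCompact S → 0 < (densityMeasure g).real S →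
      densityMeasure g (((densityMeasure g).real S ^ (n + r)⁻¹)⁻¹ • S) = 1 := by
    intro S hS hS0
    rw [← ENNReal.toReal_eq_one_iff, ← measureReal_def, hreal (by positivity) hS,
      Real.inv_rpow (by positivity), ← Real.rpow_mul hS0.le, inv_mul_cancel₀ hr.ne', Real.rpow_one,
      inv_mul_cancel₀ hS0.ne']
  -- Dilating `A` and `B` to measure one and mixing them with weights `a / (a + b)` and `b / (a +
  -- b)` produces `(a + b)⁻¹ • (A + B)`; the multiplicative inequality says that its measure is at
  -- least one.
  have hs : 0 < a / (a + b) := by positivity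
  have ht : 0 < b / (a + b) := by positivity
  have hst : a / (a + b) + b / (a + b) = 1 := by field_simp
  have key := densityMeasure_rpow_mul_rpow_le hg hnonneg hs ht hst (hlog _ _ hs ht hst)
    (hA.smul a⁻¹) (hB.smul b⁻¹)
  rw [hone hA hA0, hone hB hB0, ENNReal.one_rpow, ENNReal.one_rpow, one_mul, smul_smul, smul_smul]
    at key
  have e1 : a / (a + b) * a⁻¹ = (a + b)⁻¹ := by field_simp
  have e2 : b / (a + b) * b⁻¹ = (a + b)⁻¹ := by field_simp
  rw [e1, e2, ← smul_add] at key
  have h1 : 1 ≤ (densityMeasure g).real ((a + b)⁻¹ • (A + B)) := by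
    rw [measureReal_def, ← ENNReal.toReal_one]
    exact ENNReal.toReal_mono (densityMeasure_lt_top hg ((hA.add hB).smul _)).ne key
  rw [hreal (by positivity) (hA.add hB), Real.inv_rpow (by positivity), ← div_eq_inv_mul,
    one_le_div (by positivity)] at h1
  calc a + b = ((a + b) ^ (n + r)) ^ (n + r)⁻¹ := by
        rw [← Real.rpow_mul (by positivity), mul_inv_cancel₀ hr.ne', Real.rpow_one]
    _ ≤ _ := Real.rpow_le_rpow (by positivity) h1 (inv_nonneg.2 hr.le)

end DensityMeasure

/-! ### First-order behaviour of gauges under Minkowski addition -/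

section Gauge

variable {E : Type*} [NormedAddCommGroup E] [NormedSpace ℝ E] {K C : Set E}

theorem gauge_le_one_iff_mem (hK : Convex ℝ K) (hK0 : K ∈ 𝓝 0) (hKc : IsClosed K) {x : E} :
    gauge K x ≤ 1 ↔ x ∈ K := by
  rw [gauge_le_one_iff_mem_closure hK hK0, hKc.closure_eq]

/-- Subadditivity bounds every right difference quotient of the gauge in direction `z` by `gauge K
z`. -/
theorem fderiv_gauge_apply_le (hK : Convex ℝ K) (hK0 : K ∈ 𝓝 0) {x : E}
    (hx : DifferentiableAt ℝ (gauge K) x) (z : E) : fderiv ℝ (gauge K) x z ≤ gauge K z := by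
  have h1 := (hx.hasFDerivAt.hasLineDerivAt z).tendsto_slope_zero_right
  refine le_of_tendsto h1 ?_
  filter_upwards [self_mem_nhdsWithin] with t ht
  have ht' : 0 < t := ht
  have h2 := gauge_add_le hK (absorbent_nhds_zero hK0) x (t • z)
  rw [gauge_smul_of_nonneg ht'.le, smul_eq_mul] at h2
  rw [smul_eq_mul, inv_mul_le_iff₀ ht']
  linarith

/-- Euler's identity for a function that is positively homogeneous of degree one. -/
theorem fderiv_gauge_apply_self {x : E} (hx : DifferentiableAt ℝ (gauge K) x) :
    fderiv ℝ (gauge K) x x = gauge K x := by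
  have h1 := (hx.hasFDerivAt.hasLineDerivAt x).tendsto_slope_zero_right
  refine tendsto_nhds_unique h1 (tendsto_const_nhds.congr' ?_)
  filter_upwards [self_mem_nhdsWithin] with t ht
  have ht' : 0 < t := ht
  have : x + t • x = (1 + t) • x := by module
  rw [this, gauge_smul_of_nonneg (by positivity), smul_eq_mul, smul_eq_mul]
  field_simp
  ring

/-- The differential of the gauge at `x` is at most `1` on `K`, hence at most `1 + b` on `K + C`.
Evaluate it at the boundary point of `K + C` on the ray of `x` and use Euler's identity. -/
theorem gauge_le_mul_gauge_add_smul (hK : Convex ℝ K) (hK0 : K ∈ 𝓝 0) (hC : Convex ℝ C)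
    (hKb : IsCompact (K + C)) (hC0 : (0 : E) ∈ C) {x : E}
    (hx : DifferentiableAt ℝ (gauge K) x) {b : ℝ}
    (hb : ∀ c ∈ C, fderiv ℝ (gauge K) x c ≤ b) :
    gauge K x ≤ (1 + b) * gauge (K + C) x := by
  have hM0 : K + C ∈ 𝓝 (0 : E) := mem_of_superset hK0 (subset_add_left K hC0)
  have key : ∀ y ∈ K + C, fderiv ℝ (gauge K) x y ≤ 1 + b := by
    rintro _ ⟨k, hk, c, hc, rfl⟩
    rw [map_add]
    exact add_le_add ((fderiv_gauge_apply_le hK hK0 hx k).trans (gauge_le_one_of_mem hk)) (hb c hc)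
  rcases eq_or_ne x 0 with rfl | hx0
  · simp
  have hpos : 0 < gauge (K + C) x := (gauge_pos (absorbent_nhds_zero hM0)
    ((NormedSpace.isVonNBounded_iff ℝ).2 hKb.isBounded)).2 hx0
  have hmem : (gauge (K + C) x)⁻¹ • x ∈ K + C := by
    rw [← gauge_le_one_iff_mem (hK.add hC) hM0 hKb.isClosed,
      gauge_smul_of_nonneg (by positivity), smul_eq_mul, inv_mul_cancel₀ hpos.ne']
  have := key _ hmem
  rwa [map_smul, fderiv_gauge_apply_self hx, smul_eq_mul, inv_mul_le_iff₀ hpos, mul_comm] at this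

/-- First-order converse of the previous bound: a single `c ∈ C` with large derivative already
pushes the boundary of `K + ε • C` outwards along the ray of `x`. -/
theorem eventually_mul_gauge_add_smul_le (hK : Convex ℝ K) (hK0 : K ∈ 𝓝 0) (hKb : IsCompact K)
    {x : E} (hx0 : x ≠ 0) (hx : DifferentiableAt ℝ (gauge K) x) {c : E} (hc : c ∈ C) {a : ℝ}
    (ha : a < fderiv ℝ (gauge K) x c) :
    ∀ᶠ ε in 𝓝[>] (0 : ℝ), (1 + ε * a) * gauge (K + ε • C) x ≤ gauge K x := by
  have hpos : 0 < gauge K x := (gauge_pos (absorbent_nhds_zero hK0)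
    ((NormedSpace.isVonNBounded_iff ℝ).2 hKb.isBounded)).2 hx0
  -- The derivative along `v` is `gauge K x * (a - ℓ c) < 0`, with `ℓ` the differential at `x`, so
  -- `x + ε • v` has smaller gauge than `x`. Divided by `gauge K x` this point is `(1 + ε a) x /
  -- gauge K x - ε c`, which therefore lies in `K`.
  set v := a • x - gauge K x • c with hv
  have h1 := (hx.hasFDerivAt.hasLineDerivAt v).tendsto_slope_zero_right
  have hneg : fderiv ℝ (gauge K) x v < 0 := by
    rw [hv, map_sub, map_smul, map_smul, fderiv_gauge_apply_self hx, smul_eq_mul, smul_eq_mul]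
    nlinarith
  have h2 : Tendsto (fun ε : ℝ => 1 + ε * a) (𝓝[>] 0) (𝓝 1) := by
    have : Tendsto (fun ε : ℝ => 1 + ε * a) (𝓝 0) (𝓝 (1 + 0 * a)) :=
      Continuous.tendsto (by fun_prop) _
    simpa using this.mono_left nhdsWithin_le_nhds
  filter_upwards [h1.eventually_lt_const hneg, h2.eventually_const_lt zero_lt_one,
    self_mem_nhdsWithin] with ε hε h1ε hε0
  have hε0' : 0 < ε := hε0
  rw [smul_eq_mul, inv_mul_lt_iff₀ hε0', mul_zero, sub_neg] at hε
  have e : x + ε • v = gauge K x • ((gauge K x)⁻¹ • (1 + ε * a) • x - ε • c) := by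
    rw [smul_sub (gauge K x), smul_inv_smul₀ hpos.ne', hv]
    module
  rw [e, gauge_smul_of_nonneg hpos.le, smul_eq_mul] at hε
  have hmem : (gauge K x)⁻¹ • (1 + ε * a) • x - ε • c ∈ K := by
    rw [← gauge_le_one_iff_mem hK hK0 hKb.isClosed]
    by_contra! h
    nlinarith
  have hmem2 : (gauge K x)⁻¹ • (1 + ε * a) • x ∈ K + ε • C :=
    ⟨_, hmem, _, smul_mem_smul_set hc, by simp⟩
  have := gauge_le_one_of_mem hmem2
  rwa [gauge_smul_of_nonneg (by positivity), gauge_smul_of_nonneg h1ε.le, smul_eq_mul, smul_eq_mul,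
    inv_mul_le_iff₀ hpos, mul_one] at this

/-- The two preceding bounds squeeze the right derivative at `0` of the ratio of gauges to `b`; the
chain rule for the power gives the factor `D`, as the ratio equals `1` at `0`. -/
theorem tendsto_gauge_div_gauge_add_smul (hK : Convex ℝ K) (hK0 : K ∈ 𝓝 0) (hKb : IsCompact K)
    (hC : Convex ℝ C) (hCb : IsCompact C) (hC0 : (0 : E) ∈ C) {x : E} (hx0 : x ≠ 0)
    (hx : DifferentiableAt ℝ (gauge K) x) {b D : ℝ}
    (hb : IsGreatest (fderiv ℝ (gauge K) x '' C) b) :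
    Tendsto (fun ε : ℝ => ((gauge K x / gauge (K + ε • C) x) ^ D - 1) / ε) (𝓝[>] 0)
      (𝓝 (D * b)) := by
  set w : ℝ → ℝ := fun ε => gauge K x / gauge (K + ε • C) x with hw
  have hpos : ∀ {M : Set E}, M ∈ 𝓝 0 → IsCompact M → 0 < gauge M x := fun hM hMc =>
    (gauge_pos (absorbent_nhds_zero hM) ((NormedSpace.isVonNBounded_iff ℝ).2 hMc.isBounded)).2 hx0
  have hsub : ∀ ε : ℝ, K ⊆ K + ε • C := fun ε =>
    subset_add_left K ⟨0, hC0, by simp⟩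
  have hψ : ∀ ε : ℝ, 0 < gauge (K + ε • C) x := fun ε =>
    hpos (mem_of_superset hK0 (hsub ε)) (hKb.add (hCb.smul ε))
  have hw0 : w 0 = 1 := by
    have : (0 : ℝ) • C = 0 := zero_smul_set ⟨0, hC0⟩
    simp only [hw, this, add_zero]
    exact div_self (hpos hK0 hKb).ne'
  have hderiv : HasDerivWithinAt w b (Ioi 0) 0 := by
    rw [hasDerivWithinAt_iff_tendsto_slope' (by simp)]
    obtain ⟨⟨c, hc, hcb⟩, hub⟩ := hb
    rw [tendsto_order]
    refine ⟨fun a ha => ?_, fun a ha => ?_⟩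
    · obtain ⟨a', haa', ha'b⟩ := exists_between ha
      filter_upwards [eventually_mul_gauge_add_smul_le hK hK0 hKb hx0 hx hc (hcb.symm ▸ ha'b),
        self_mem_nhdsWithin] with ε hε hε0
      have hε0' : 0 < ε := hε0
      rw [slope_def_field, hw0, sub_zero, lt_div_iff₀ hε0']
      have : 1 + ε * a' ≤ w ε := (le_div_iff₀ (hψ ε)).2 hε
      nlinarith
    · filter_upwards [self_mem_nhdsWithin] with ε hε0
      have hε0' : 0 < ε := hε0
      rw [slope_def_field, hw0, sub_zero, div_lt_iff₀ hε0']
      have : w ε ≤ 1 + ε * b := by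
        rw [div_le_iff₀ (hψ ε)]
        refine gauge_le_mul_gauge_add_smul hK hK0 (hC.smul ε) (hKb.add (hCb.smul ε))
          ⟨0, hC0, by simp⟩ hx ?_
        rintro _ ⟨c', hc', rfl⟩
        simp only [map_smul, smul_eq_mul]
        exact mul_le_mul_of_nonneg_left (hub ⟨c', hc', rfl⟩) hε0'.le
      nlinarith
  have h2 := hderiv.rpow_const (p := D) (Or.inl (by simp [hw0]))
  rw [hasDerivWithinAt_iff_tendsto_slope' (by simp), hw0, Real.one_rpow, mul_one] at h2
  rw [mul_comm D b]
  refine h2.congr fun ε => ?_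
  rw [slope_def_field, hw0, Real.one_rpow, sub_zero]

/-- A dominating constant independent of `ε`: on `[1, 1 + H]` the convex function `w ^ D` lies below
its chord. -/
theorem rpow_sub_one_div_le {D H ε w : ℝ} (hD : 1 ≤ D) (hH : 0 ≤ H) (hε : 0 < ε) (hε1 : ε ≤ 1)
    (hw : 1 ≤ w) (hwε : w ≤ 1 + ε * H) : ‖(w ^ D - 1) / ε‖ ≤ (1 + H) ^ D - 1 := by
  have h1 : 1 ≤ w ^ D := Real.one_le_rpow hw (by linarith)
  rw [Real.norm_eq_abs, abs_of_nonneg (div_nonneg (by linarith) hε.le), div_le_iff₀ hε]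
  have h2 : ((1 - ε) • 1 + ε • (1 + H)) ^ D ≤ (1 - ε) • (1 : ℝ) ^ D + ε • (1 + H) ^ D :=
    (convexOn_rpow hD).2 (by simp) (mem_Ici.2 (by linarith)) (by linarith) hε.le (by ring)
  simp only [smul_eq_mul, Real.one_rpow, mul_one] at h2
  have h3 : w ^ D ≤ (1 - ε + ε * (1 + H)) ^ D :=
    Real.rpow_le_rpow (by linarith) (by linarith) (by linarith)
  nlinarith

end Gauge

/-- The origin is the midpoint of an interior point `x` and `-x ∈ K`. -/
theorem IsConvexBody.mem_nhds_zero {n : ℕ} {K : Set (EuclideanSpace ℝ (Fin n))}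
    (hK : IsConvexBody K) (hs : IsOriginSymmetric K) : K ∈ 𝓝 0 := by
  obtain ⟨x, hx⟩ := hK.interior_nonempty
  have hx' : -x ∈ K := by
    have : K = -K := hs.symm
    rw [this]
    simpa using interior_subset hx
  have := hK.convex.combo_interior_self_mem_interior hx hx' (a := 1 / 2) (b := 1 / 2) (by norm_num)
    (by norm_num) (by norm_num)
  rw [smul_neg, add_neg_cancel] at this
  exact mem_interior_iff_mem_nhds.1 this

/-! ### First variation of the measure -/

section Derivative

variable {n : ℕ} {g : EuclideanSpace ℝ (Fin n) → ℝ} {r : ℝ}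
  {K C : Set (EuclideanSpace ℝ (Fin n))}

/-- Rademacher's theorem: the gauge is Lipschitz and the measure is absolutely continuous. -/
theorem ae_differentiableAt_gauge (hK : Convex ℝ K) (hK0 : K ∈ 𝓝 0) :
    ∀ᵐ x ∂(densityMeasure g), DifferentiableAt ℝ (gauge K) x := by
  obtain ⟨k, hk⟩ := hK.lipschitz_gauge hK0
  exact (withDensity_absolutelyContinuous _ _).ae_le hk.ae_differentiableAt

theorem setOf_gauge_le_one (hK : Convex ℝ K) (hK0 : K ∈ 𝓝 0) (hKb : IsCompact K) :
    {x | gauge K x ≤ 1} = K := by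
  ext x
  exact gauge_le_one_iff_mem hK hK0 hKb.isClosed

/-- The first variation of the measure of a convex body. -/
theorem tendsto_densityMeasure_add_smul_sub_div (hn : 1 ≤ n) (hg : Continuous g)
    (hhom : IsHomogeneousOfDegree r g) (hr : 0 ≤ r) (hK : Convex ℝ K) (hK0 : K ∈ 𝓝 0)
    (hKb : IsCompact K) (hC : Convex ℝ C) (hCb : IsCompact C) (hC0 : 0 ∈ C)
    {h : (EuclideanSpace ℝ (Fin n) →L[ℝ] ℝ) → ℝ} (hh : ∀ ℓ : EuclideanSpace ℝ (Fin n) →L[ℝ] ℝ, IsGreatest (ℓ '' C) (h ℓ)) :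
    Tendsto (fun ε : ℝ => ((densityMeasure g).real (K + ε • C) - (densityMeasure g).real K) / ε)
      (𝓝[>] 0)
      (𝓝 ((n + r) * ∫ x in K, h (fderiv ℝ (gauge K) x) ∂(densityMeasure g))) := by
  have hn' : (1 : ℝ) ≤ n := by exact_mod_cast hn
  have hD : (1 : ℝ) ≤ n + r := by linarith
  have hsub : ∀ ε : ℝ, K ⊆ K + ε • C := fun ε => subset_add_left K ⟨0, hC0, by simp⟩
  have hM0 : ∀ ε : ℝ, K + ε • C ∈ 𝓝 0 := fun ε => mem_of_superset hK0 (hsub ε)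
  have hMb : ∀ ε : ℝ, IsCompact (K + ε • C) := fun ε => hKb.add (hCb.smul ε)
  have hMc : ∀ ε : ℝ, Convex ℝ (K + ε • C) := fun ε => hK.add (hC.smul ε)
  have hpos : ∀ {M : Set (EuclideanSpace ℝ (Fin n))}, M ∈ 𝓝 0 → IsCompact M → ∀ x, x ≠ 0 →
      0 < gauge M x := fun hM hMc x hx0 =>
    (gauge_pos (absorbent_nhds_zero hM) ((NormedSpace.isVonNBounded_iff ℝ).2 hMc.isBounded)).2 hx0
  have hghom : ∀ M : Set (EuclideanSpace ℝ (Fin n)), ∀ a : ℝ, 0 < a → ∀ x,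
      gauge M (a • x) = a * gauge M x := fun M a ha x => by
    rw [gauge_smul_of_nonneg ha.le, smul_eq_mul]
  have : Fact (densityMeasure g K < ⊤) := ⟨densityMeasure_lt_top hg hKb⟩
  have hfin : IsFiniteMeasure ((densityMeasure g).restrict K) := inferInstance
  -- `H` bounds the differential of the gauge on `C` wherever it exists, which makes the domination
  -- uniform in `x`.
  obtain ⟨H, hH⟩ : ∃ H, ∀ c ∈ C, gauge K c ≤ H := by
    obtain ⟨H, hH⟩ := hCb.bddAbove_image (continuous_gauge hK hK0).continuousOn
    exact ⟨H, fun c hc => hH ⟨c, hc, rfl⟩⟩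
  have hHnn : 0 ≤ H := by simpa using hH 0 hC0
  have hne : ∀ᵐ x ∂(densityMeasure g), x ≠ 0 := by
    have : Nontrivial (EuclideanSpace ℝ (Fin n)) := by
      apply Module.nontrivial_of_finrank_pos (R := ℝ)
      simp; lia
    refine (withDensity_absolutelyContinuous _ _).ae_le ?_
    exact Measure.ae_ne volume 0
  have hmeas : ∀ ε : ℝ, Measurable fun x => (gauge K x / gauge (K + ε • C) x) ^ (n + r) := fun ε =>
    ((continuous_gauge hK hK0).measurable.div
      (continuous_gauge (hMc ε) (hM0 ε)).measurable).pow_const _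
  have hbound : ∀ ε : ℝ, 0 < ε → ∀ x, x ≠ 0 → DifferentiableAt ℝ (gauge K) x →
      1 ≤ gauge K x / gauge (K + ε • C) x ∧ gauge K x / gauge (K + ε • C) x ≤ 1 + ε * H := by
    intro ε hε x hx0 hx
    have hψ := hpos (hM0 ε) (hMb ε) x hx0
    refine ⟨(one_le_div hψ).2 (gauge_mono (absorbent_nhds_zero hK0) (hsub ε) x),
      (div_le_iff₀ hψ).2 ?_⟩
    refine gauge_le_mul_gauge_add_smul hK hK0 (hC.smul ε) (hMb ε) ⟨0, hC0, by simp⟩ hx ?_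
    rintro _ ⟨c', hc', rfl⟩
    simp only [map_smul, smul_eq_mul]
    exact mul_le_mul_of_nonneg_left ((fderiv_gauge_apply_le hK hK0 hx c').trans (hH c' hc')) hε.le
  have hint : ∀ ε : ℝ, 0 < ε → IntegrableOn
      (fun x => (gauge K x / gauge (K + ε • C) x) ^ (n + r)) K (densityMeasure g) := by
    intro ε hε
    refine Integrable.of_bound (C := (1 + ε * H) ^ (n + r)) (hmeas ε).aestronglyMeasurable ?_
    filter_upwards [ae_restrict_of_ae hne, ae_restrict_of_ae (ae_differentiableAt_gauge hK hK0)]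
      with x hx0 hx
    obtain ⟨h1, h2⟩ := hbound ε hε x hx0 hx
    rw [Real.norm_eq_abs, abs_of_nonneg (by positivity)]
    gcongr
  -- The domain of integration no longer depends on `ε`, so dominated convergence applies to the
  -- difference quotients.
  have hmass : ∀ ε : ℝ, (densityMeasure g).real (K + ε • C) =
      ∫ x in K, (gauge K x / gauge (K + ε • C) x) ^ (n + r) ∂(densityMeasure g) := by
    intro ε
    rw [integral_eq_lintegral_of_nonneg_ae (Eventually.of_forall fun x => Real.rpow_nonneg
      (div_nonneg (gauge_nonneg _) (gauge_nonneg _)) _) (hmeas ε).aestronglyMeasurable,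
      measureReal_def]
    congr 1
    have := densityMeasure_eq_setLIntegral hn hg hhom (by linarith)
      (continuous_gauge hK hK0).measurable (continuous_gauge (hMc ε) (hM0 ε)).measurable
      (hghom K) (hpos hK0 hKb) (hghom _) (hpos (hM0 ε) (hMb ε))
    rwa [setOf_gauge_le_one hK hK0 hKb, setOf_gauge_le_one (hMc ε) (hM0 ε) (hMb ε)] at this
  have hquot : ∀ ε : ℝ, 0 < ε →
      ((densityMeasure g).real (K + ε • C) - (densityMeasure g).real K) / ε =
      ∫ x in K, ((gauge K x / gauge (K + ε • C) x) ^ (n + r) - 1) / ε ∂(densityMeasure g) := by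
    intro ε hε
    rw [integral_div, integral_sub (hint ε hε) (integrable_const _), ← hmass]
    simp
  rw [← integral_const_mul]
  have hev : ∀ᶠ ε : ℝ in 𝓝[>] 0, 0 < ε ∧ ε ≤ 1 := by
    filter_upwards [Ioc_mem_nhdsGT (zero_lt_one (α := ℝ))] with ε hε using hε
  refine Tendsto.congr' (f₁ := fun ε : ℝ => ∫ x in K,
    ((gauge K x / gauge (K + ε • C) x) ^ (n + r) - 1) / ε ∂(densityMeasure g)) ?_ ?_
  · filter_upwards [hev] with ε hε using (hquot ε hε.1).symm
  refine tendsto_integral_filter_of_dominated_convergence (fun _ => (1 + H) ^ (n + r) - 1)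
    (Eventually.of_forall fun ε =>
      (((hmeas ε).sub_const 1).div_const ε).aestronglyMeasurable) ?_ (integrable_const _) ?_
  · filter_upwards [hev] with ε hε
    filter_upwards [ae_restrict_of_ae hne, ae_restrict_of_ae (ae_differentiableAt_gauge hK hK0)]
      with x hx0 hx
    obtain ⟨h1, h2⟩ := hbound ε hε.1 x hx0 hx
    exact rpow_sub_one_div_le hD hHnn hε.1 hε.2 h1 h2
  · filter_upwards [ae_restrict_of_ae hne, ae_restrict_of_ae (ae_differentiableAt_gauge hK hK0)]
      with x hx0 hx
    exact tendsto_gauge_div_gauge_add_smul hK hK0 hKb hC hCb hC0 hx0 hx (hh _)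

end Derivative

/-! ### Averaging over random rotations -/

/-- A random linear isometry `ρ` of `ℝⁿ` whose law is invariant under composition with isometries
on the right. -/
structure IsRotationInvariant {n : ℕ} {G : Type*} [MeasurableSpace G] (ν : Measure G)
    (ρ : G → EuclideanSpace ℝ (Fin n) ≃ₗᵢ[ℝ] EuclideanSpace ℝ (Fin n)) : Prop where
  measurable : Measurable fun z : G × EuclideanSpace ℝ (Fin n) => ρ z.1 z.2
  lintegral_comp : ∀ (V : EuclideanSpace ℝ (Fin n) ≃ₗᵢ[ℝ] EuclideanSpace ℝ (Fin n))
    (f : EuclideanSpace ℝ (Fin n) → ℝ≥0∞) (x : EuclideanSpace ℝ (Fin n)),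
    ∫⁻ U, f (ρ U (V x)) ∂ν = ∫⁻ U, f (ρ U x) ∂ν

/-- Normalized Haar measure on the orthogonal group, which is closed and bounded in the space of
operators and hence compact. -/
theorem exists_isRotationInvariant (n : ℕ) : ∃ (G : Type) (_ : MeasurableSpace G) (ν : Measure G)
    (ρ : G → EuclideanSpace ℝ (Fin n) ≃ₗᵢ[ℝ] EuclideanSpace ℝ (Fin n)),
    IsProbabilityMeasure ν ∧ IsRotationInvariant ν ρ := by
  have hstar : ContinuousStar (EuclideanSpace ℝ (Fin n) →L[ℝ] EuclideanSpace ℝ (Fin n)) :=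
    ⟨(ContinuousLinearMap.adjoint (𝕜 := ℝ) (E := EuclideanSpace ℝ (Fin n))
      (F := EuclideanSpace ℝ (Fin n))).continuous⟩
  let G := unitary (EuclideanSpace ℝ (Fin n) →L[ℝ] EuclideanSpace ℝ (Fin n))
  have hproper : ProperSpace (EuclideanSpace ℝ (Fin n) →L[ℝ] EuclideanSpace ℝ (Fin n)) :=
    FiniteDimensional.proper_real _
  have hcompact : CompactSpace G := by
    refine (isCompact_iff_compactSpace (s := (G : Set (EuclideanSpace ℝ (Fin n) →L[ℝ]
      EuclideanSpace ℝ (Fin n))))).1 ?_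
    refine Metric.isCompact_of_isClosed_isBounded isClosed_unitary ?_
    refine (Metric.isBounded_closedBall (x := (0 : EuclideanSpace ℝ (Fin n) →L[ℝ] _))
      (r := 1)).subset fun u hu => ?_
    rw [mem_closedBall_zero_iff]
    refine ContinuousLinearMap.opNorm_le_bound _ zero_le_one fun x => ?_
    rw [one_mul]
    exact (Unitary.norm_map ⟨u, hu⟩ x).le
  let ν : Measure G := Measure.haarMeasure ⊤
  have hν : IsProbabilityMeasure ν := ⟨by
    have := Measure.haarMeasure_self (G := G) (K₀ := ⊤)
    simpa using this⟩
  -- The inverse turns left invariance of Haar measure into invariance under composition on the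
  -- right: `U⁻¹ V = (V⁻¹ U)⁻¹`.
  refine ⟨G, inferInstance, ν, fun U => Unitary.linearIsometryEquiv U⁻¹, hν, ⟨?_, ?_⟩⟩
  · have : Continuous fun z : G × EuclideanSpace ℝ (Fin n) =>
        ((z.1⁻¹ : G) : EuclideanSpace ℝ (Fin n) →L[ℝ] EuclideanSpace ℝ (Fin n)) z.2 :=
      (continuous_subtype_val.comp (continuous_inv.comp continuous_fst)).clm_apply continuous_snd
    exact this.measurable
  · intro V f x
    let W : G := Unitary.linearIsometryEquiv.symm V
    have e : ∀ U : G, Unitary.linearIsometryEquiv U⁻¹ (V x) =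
        Unitary.linearIsometryEquiv (W⁻¹ * U)⁻¹ x := by
      intro U
      rw [mul_inv_rev, inv_inv, map_mul]
      simp [W]
    simp only [e]
    exact lintegral_mul_left_eq_self (fun U : G => f (Unitary.linearIsometryEquiv U⁻¹ x)) W⁻¹

section Rotation

variable {n : ℕ} {G : Type*} [MeasurableSpace G] {ν : Measure G}
  {ρ : G → EuclideanSpace ℝ (Fin n) ≃ₗᵢ[ℝ] EuclideanSpace ℝ (Fin n)}

/-- A reflection exchanges two vectors of equal norm. -/
theorem IsRotationInvariant.lintegral_eq (h : IsRotationInvariant ν ρ)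
    (f : EuclideanSpace ℝ (Fin n) → ℝ≥0∞) {x y : EuclideanSpace ℝ (Fin n)} (hxy : ‖x‖ = ‖y‖) :
    ∫⁻ U, f (ρ U x) ∂ν = ∫⁻ U, f (ρ U y) ∂ν := by
  rw [← Submodule.reflection_sub hxy, h.lintegral_comp]

/-- Rotations preserve Lebesgue measure and the norm, so against a radial weight `f` may be replaced
by its rotation average. -/
theorem IsRotationInvariant.lintegral_mul_norm [IsProbabilityMeasure ν]
    (h : IsRotationInvariant ν ρ) {f : EuclideanSpace ℝ (Fin n) → ℝ≥0∞} (hf : Measurable f)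
    {k : ℝ → ℝ≥0∞} (hk : Measurable k) :
    ∫⁻ x, f x * k ‖x‖ = ∫⁻ x, (∫⁻ U, f (ρ U x) ∂ν) * k ‖x‖ := by
  have hm : Measurable fun z : G × EuclideanSpace ℝ (Fin n) => f (ρ z.1 z.2) * k ‖z.2‖ :=
    (hf.comp h.measurable).mul (hk.comp measurable_snd.norm)
  calc ∫⁻ x, f x * k ‖x‖ = ∫⁻ _ : G, (∫⁻ x, f x * k ‖x‖) ∂ν := by simp
    _ = ∫⁻ U, (∫⁻ x, f (ρ U x) * k ‖x‖) ∂ν := by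
        refine lintegral_congr fun U => ?_
        rw [← (ρ U).measurePreserving.lintegral_comp
          (f := fun x => f x * k ‖x‖) (hf.mul (hk.comp measurable_norm))]
        simp
    _ = ∫⁻ x, ∫⁻ U, f (ρ U x) * k ‖x‖ ∂ν := lintegral_lintegral_swap hm.aemeasurable
    _ = _ := by
        refine lintegral_congr fun x => ?_
        exact lintegral_mul_const _ (hf.comp (h.measurable.comp measurable_prodMk_right))

end Rotation

theorem lintegral_fun_norm {E : Type*} [NormedAddCommGroup E] [NormedSpace ℝ E]
    [MeasurableSpace E] [BorelSpace E] [FiniteDimensional ℝ E] [Nontrivial E] (μ : Measure E)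
    [μ.IsAddHaarMeasure] {f : ℝ → ℝ≥0∞} (hf : Measurable f) :
    ∫⁻ x, f ‖x‖ ∂μ = Module.finrank ℝ E * μ (Metric.ball 0 1) *
      ∫⁻ s in Ioi (0 : ℝ), ENNReal.ofReal (s ^ (Module.finrank ℝ E - 1)) * f s := by
  rw [lintegral_eq_lintegral_toSphere μ (f := fun x => f ‖x‖) (hf.comp measurable_norm),
    ← μ.toSphere_apply_univ, mul_comm]
  have : ∀ θ : Metric.sphere (0 : E) 1, (∫⁻ s in Ioi (0 : ℝ),
      ENNReal.ofReal (s ^ (Module.finrank ℝ E - 1)) * f ‖s • (θ : E)‖) = ∫⁻ s in Ioi (0 : ℝ),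
      ENNReal.ofReal (s ^ (Module.finrank ℝ E - 1)) * f s := by
    intro θ
    refine setLIntegral_congr_fun measurableSet_Ioi fun s hs => ?_
    have hs' : 0 < s := hs
    simp [norm_smul, abs_of_pos hs']
  simp [this]

/-- The average over all rotations of the integral over a linear hyperplane. -/
theorem IsRotationInvariant.lintegral_hyperplane {m : ℕ} (hm : 1 ≤ m) {G : Type*}
    [MeasurableSpace G] {ν : Measure G} [IsProbabilityMeasure ν]
    {ρ : G → EuclideanSpace ℝ (Fin (m + 1)) ≃ₗᵢ[ℝ] EuclideanSpace ℝ (Fin (m + 1))}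
    (h : IsRotationInvariant ν ρ) (ι : EuclideanSpace ℝ (Fin m) →ₗᵢ[ℝ] EuclideanSpace ℝ (Fin (m + 1)))
    {f : EuclideanSpace ℝ (Fin (m + 1)) → ℝ≥0∞} (hf : Measurable f) :
    (m + 1) * volume (Metric.ball (0 : EuclideanSpace ℝ (Fin (m + 1))) 1) *
      ∫⁻ U, (∫⁻ y, f (ρ U (ι y))) ∂ν =
    m * volume (Metric.ball (0 : EuclideanSpace ℝ (Fin m)) 1) *
      ∫⁻ x, f x * ENNReal.ofReal ‖x‖⁻¹ := by
  have : Nontrivial (EuclideanSpace ℝ (Fin m)) := by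
    apply Module.nontrivial_of_finrank_pos (R := ℝ)
    simp; lia
  obtain ⟨e, he⟩ : ∃ e : EuclideanSpace ℝ (Fin (m + 1)), ‖e‖ = 1 :=
    ⟨EuclideanSpace.single 0 1, by simp⟩
  -- The rotation average of `f` is radial, with profile `F`; both sides then reduce to
  -- one-dimensional integrals of `F`.
  set F : ℝ → ℝ≥0∞ := fun s => ∫⁻ U, f (ρ U (s • e)) ∂ν with hF
  have hF' : ∀ x, ∫⁻ U, f (ρ U x) ∂ν = F ‖x‖ := fun x =>
    h.lintegral_eq f (by simp [norm_smul, he])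
  have hFm : Measurable F := by
    have : Measurable fun z : G × ℝ => f (ρ z.1 (z.2 • e)) :=
      hf.comp (h.measurable.comp (measurable_fst.prodMk (measurable_snd.smul_const e)))
    exact this.lintegral_prod_left'
  have h1 : ∫⁻ U, (∫⁻ y, f (ρ U (ι y))) ∂ν = ∫⁻ y : EuclideanSpace ℝ (Fin m), F ‖y‖ := by
    rw [lintegral_lintegral_swap]
    · refine lintegral_congr fun y => ?_
      rw [hF', ι.norm_map]
    · exact (hf.comp (h.measurable.comp
        (measurable_fst.prodMk (ι.continuous.measurable.comp measurable_snd)))).aemeasurable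
  have h2 : ∫⁻ x, f x * ENNReal.ofReal ‖x‖⁻¹ =
      ∫⁻ x : EuclideanSpace ℝ (Fin (m + 1)), F ‖x‖ * ENNReal.ofReal ‖x‖⁻¹ := by
    rw [h.lintegral_mul_norm hf (k := fun s => ENNReal.ofReal s⁻¹) (by fun_prop)]
    simp only [hF']
  rw [h1, h2, lintegral_fun_norm _ hFm,
    lintegral_fun_norm volume (f := fun s => F s * ENNReal.ofReal s⁻¹) (by fun_prop)]
  -- The weight `‖x‖⁻¹` lowers the radial density `s ^ m` of dimension `m + 1` to the density `s ^
  -- (m - 1)` of dimension `m`.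
  have h3 : (∫⁻ s in Ioi (0 : ℝ), ENNReal.ofReal (s ^ (m + 1 - 1)) * (F s * ENNReal.ofReal s⁻¹)) =
      ∫⁻ s in Ioi (0 : ℝ), ENNReal.ofReal (s ^ (m - 1)) * F s := by
    refine setLIntegral_congr_fun measurableSet_Ioi fun s hs => ?_
    have hs' : 0 < s := hs
    rw [mul_comm (F s), ← mul_assoc, ← ENNReal.ofReal_mul (by positivity)]
    congr 2
    obtain ⟨k, rfl⟩ : ∃ k, m = k + 1 := ⟨m - 1, by lia⟩
    simp only [Nat.add_sub_cancel, pow_succ]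
    field_simp
  simp only [finrank_euclideanSpace, Fintype.card_fin, h3]
  push_cast
  ring

/-! ### Ball volumes and Gaussian integrals -/

theorem ballVolume_eq (k : ℕ) : ballVolume k = √Real.pi ^ k / Real.Gamma (k / 2 + 1) := by
  rw [ballVolume, unitBall, measureReal_def]
  rcases Nat.eq_zero_or_pos k with rfl | hk
  · have h1 : Metric.closedBall (0 : EuclideanSpace ℝ (Fin 0)) 1 = univ := by
      ext x
      simp [Subsingleton.elim x 0]
    rw [h1, ← (PiLp.volume_preserving_toLp (Fin 0)).measure_preimage MeasurableSet.univ.nullMeasurableSet,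
      preimage_univ, volume_pi, Measure.pi_of_empty _ 0]
    simp
  · have : Nonempty (Fin k) := ⟨⟨0, hk⟩⟩
    rw [EuclideanSpace.volume_closedBall, Fintype.card_fin, ENNReal.ofReal_one, one_pow, one_mul,
      ENNReal.toReal_ofReal]
    have : 0 < Real.Gamma (k / 2 + 1) := Real.Gamma_pos_of_pos (by positivity)
    positivity

theorem ballVolume_pos (k : ℕ) : 0 < ballVolume k := by
  rw [ballVolume_eq]
  have : 0 < Real.Gamma (k / 2 + 1) := Real.Gamma_pos_of_pos (by positivity)
  have := Real.pi_pos
  positivity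

theorem volume_real_ball_zero_one {k : ℕ} (hk : 1 ≤ k) :
    volume.real (Metric.ball (0 : EuclideanSpace ℝ (Fin k)) 1) = ballVolume k := by
  have : Nontrivial (EuclideanSpace ℝ (Fin k)) := by
    apply Module.nontrivial_of_finrank_pos (R := ℝ)
    simp; lia
  rw [ballVolume, unitBall, measureReal_def, measureReal_def, Measure.addHaar_closedBall_eq_addHaar_ball]

theorem integral_abs_mul_exp_neg_sq : ∫ s : ℝ, |s| * Real.exp (-s ^ 2) = 1 := by
  have h1 := integral_comp_abs (f := fun s : ℝ => s * Real.exp (-s ^ 2))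
  have h2 := integral_rpow_mul_exp_neg_rpow (p := 2) (q := 1) (by norm_num) (by norm_num)
  have h3 : ∫ s in Ioi (0 : ℝ), s * Real.exp (-s ^ 2) = 1 / 2 := by
    norm_num at h2
    exact h2
  simp only [sq_abs] at h1
  rw [h1, h3]
  norm_num

/-- The integrand is a product over coordinates: the first factor integrates to `1`, each of the
other `m` to `√π`. -/
theorem integral_abs_coord_mul_exp_neg_norm_sq (m : ℕ) :
    ∫ x : EuclideanSpace ℝ (Fin (m + 1)), |x 0| * Real.exp (-‖x‖ ^ 2) = √Real.pi ^ m := by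
  have hp := PiLp.volume_preserving_toLp (Fin (m + 1))
  have hemb : MeasurableEmbedding (WithLp.toLp 2 : (Fin (m + 1) → ℝ) → _) :=
    (MeasurableEquiv.toLp 2 (Fin (m + 1) → ℝ)).measurableEmbedding
  rw [← hp.integral_comp hemb]
  have e : ∀ x : Fin (m + 1) → ℝ, |(WithLp.toLp 2 x : EuclideanSpace ℝ (Fin (m + 1))) 0| *
      Real.exp (-‖(WithLp.toLp 2 x : EuclideanSpace ℝ (Fin (m + 1)))‖ ^ 2) =
      ∏ i, (Fin.cons (fun s : ℝ => |s| * Real.exp (-s ^ 2))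
        (fun _ => fun s : ℝ => Real.exp (-s ^ 2)) : Fin (m + 1) → ℝ → ℝ) i (x i) := by
    intro x
    rw [EuclideanSpace.norm_sq_eq, Fin.sum_univ_succ, Fin.prod_univ_succ, neg_add, Real.exp_add,
      ← Finset.sum_neg_distrib, Real.exp_sum]
    simp [mul_assoc]
  simp only [e]
  rw [integral_fintype_prod_volume_eq_prod, Fin.prod_univ_succ]
  have := integral_gaussian 1
  simp only [neg_mul, one_mul, div_one] at this
  simp [integral_abs_mul_exp_neg_sq, this]

theorem integral_abs_inner_mul_exp_neg_norm_sq {m : ℕ} (v : EuclideanSpace ℝ (Fin (m + 1))) :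
    ∫ x, |inner ℝ v x| * Real.exp (-‖x‖ ^ 2) = ‖v‖ * √Real.pi ^ m := by
  set w : EuclideanSpace ℝ (Fin (m + 1)) := EuclideanSpace.single 0 ‖v‖ with hw
  have hvw : ‖w‖ = ‖v‖ := by simp [hw]
  set V := (Submodule.span ℝ {w - v})ᗮ.reflection with hV
  have hVw : V w = v := Submodule.reflection_sub hvw
  rw [← V.measurePreserving.integral_comp V.toHomeomorph.measurableEmbedding,
    ← integral_abs_coord_mul_exp_neg_norm_sq, ← integral_const_mul]
  refine integral_congr_ae (Eventually.of_forall fun x => ?_)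
  simp only [V.norm_map]
  conv_lhs => rw [← hVw, V.inner_map_map]
  rw [hw, EuclideanSpace.inner_single_left]
  simp [abs_mul, mul_assoc]

theorem integral_norm_mul_exp_neg_norm_sq (m : ℕ) :
    ∫ x : EuclideanSpace ℝ (Fin (m + 1)), ‖x‖ * Real.exp (-‖x‖ ^ 2) =
      (m + 1) * ballVolume (m + 1) * (Real.Gamma (m / 2 + 1) / 2) := by
  rw [integral_fun_norm_addHaar volume (fun s => s * Real.exp (-s ^ 2)), finrank_euclideanSpace,
    Fintype.card_fin, volume_real_ball_zero_one (by lia)]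
  have h2 := integral_rpow_mul_exp_neg_rpow (p := 2) (q := m + 1) (by norm_num)
    (by linarith [Nat.cast_nonneg (α := ℝ) m])
  have h3 : ∫ s in Ioi (0 : ℝ), s ^ (m + 1 - 1) • (s * Real.exp (-s ^ 2)) =
      Real.Gamma (m / 2 + 1) / 2 := by
    rw [show ((m : ℝ) / 2 + 1) = (m + 1 + 1) / 2 by ring, div_eq_inv_mul, ← one_div, ← h2]
    refine setIntegral_congr_fun measurableSet_Ioi fun s hs => ?_
    have hs' : 0 < s := hs
    have : s ^ ((m : ℝ) + 1) = s ^ m * s := by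
      rw [Real.rpow_add hs', Real.rpow_natCast, Real.rpow_one]
    simp [this, mul_assoc]
  rw [h3]
  simp [mul_assoc]

theorem lintegral_ofReal_eq_ofReal_integral {α : Type*} [MeasurableSpace α] {μ : Measure α}
    {f : α → ℝ} (hf : ∀ x, 0 ≤ f x) (h : ∫ x, f x ∂μ ≠ 0) :
    ∫⁻ x, ENNReal.ofReal (f x) ∂μ = ENNReal.ofReal (∫ x, f x ∂μ) :=
  (ofReal_integral_eq_lintegral_ofReal (Integrable.of_integral_ne_zero h)
    (Eventually.of_forall hf)).symm

/-- The average of the absolute value of a linear functional over all unit vectors. -/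
theorem IsRotationInvariant.lintegral_abs_apply {m : ℕ} {G : Type*}
    [MeasurableSpace G] {ν : Measure G} [IsProbabilityMeasure ν]
    {ρ : G → EuclideanSpace ℝ (Fin (m + 1)) ≃ₗᵢ[ℝ] EuclideanSpace ℝ (Fin (m + 1))}
    (h : IsRotationInvariant ν ρ) {e : EuclideanSpace ℝ (Fin (m + 1))} (he : ‖e‖ = 1)
    (ℓ : EuclideanSpace ℝ (Fin (m + 1)) →L[ℝ] ℝ) :
    ∫⁻ U, ENNReal.ofReal |ℓ (ρ U e)| ∂ν =
      ENNReal.ofReal (2 * ballVolume m / ((m + 1) * ballVolume (m + 1)) * ‖ℓ‖) := by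
  rcases eq_or_ne ℓ 0 with rfl | hℓ
  · simp
  obtain ⟨v, rfl⟩ := (InnerProductSpace.toDual ℝ (EuclideanSpace ℝ (Fin (m + 1)))).surjective ℓ
  simp only [InnerProductSpace.toDual_apply_apply, LinearIsometryEquiv.norm_map]
  have hv : 0 < ‖v‖ := by
    rw [norm_pos_iff]
    rintro rfl
    simp at hℓ
  have hpi := Real.pi_pos
  have hΓ : 0 < Real.Gamma ((m : ℝ) / 2 + 1) := Real.Gamma_pos_of_pos (by positivity)
  have hb := ballVolume_pos (m + 1)
  set A := ∫⁻ U, ENNReal.ofReal |inner ℝ v (ρ U e)| ∂ν with hA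
  -- The average `A` over unit vectors is found by integrating `|⟨v, x⟩|` against a Gaussian in two
  -- ways: directly, and after rotation averaging, where it becomes `A` times the integral of `‖x‖`.
  have h1 := h.lintegral_mul_norm (f := fun x => ENNReal.ofReal |inner ℝ v x|) (by fun_prop)
    (k := fun s => ENNReal.ofReal (Real.exp (-s ^ 2))) (by fun_prop)
  have h2 : ∀ x, ∫⁻ U, ENNReal.ofReal |inner ℝ v (ρ U x)| ∂ν = A * ENNReal.ofReal ‖x‖ := by
    intro x
    rw [h.lintegral_eq (fun x => ENNReal.ofReal |inner ℝ v x|) (y := ‖x‖ • e)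
      (by simp [norm_smul, he]), hA, ← lintegral_mul_const' _ _ ENNReal.ofReal_ne_top]
    refine lintegral_congr fun U => ?_
    rw [map_smul, inner_smul_right, abs_mul, abs_norm, mul_comm, ENNReal.ofReal_mul (abs_nonneg _)]
  simp only [h2, mul_assoc] at h1
  rw [lintegral_const_mul _ (by fun_prop)] at h1
  simp only [← ENNReal.ofReal_mul (abs_nonneg _), ← ENNReal.ofReal_mul (norm_nonneg _)] at h1
  have e1 := integral_abs_inner_mul_exp_neg_norm_sq v
  have e2 := integral_norm_mul_exp_neg_norm_sq m
  rw [lintegral_ofReal_eq_ofReal_integral (fun x => by positivity) (by rw [e1]; positivity),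
    lintegral_ofReal_eq_ofReal_integral (fun x => by positivity) (by rw [e2]; positivity),
    e1, e2] at h1
  set c := ((m : ℝ) + 1) * ballVolume (m + 1) * (Real.Gamma (m / 2 + 1) / 2) with hc
  have hc0 : 0 < c := by positivity
  rw [← ENNReal.mul_left_inj (c := ENNReal.ofReal c) (by simpa using hc0) ENNReal.ofReal_ne_top, ← h1,
    ← ENNReal.ofReal_mul (by have := ballVolume_pos m; positivity)]
  congr 1
  rw [hc, ballVolume_eq m]
  field_simp

/-! ### The integral of the inverse norm -/

section Ball

variable {n : ℕ} {g : EuclideanSpace ℝ (Fin n) → ℝ} {r : ℝ}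

theorem setLIntegral_closedBall_rpow_norm (hn : 1 ≤ n) (hg : Continuous g)
    (hhom : IsHomogeneousOfDegree r g) {a b : ℝ} (ha : 0 < n + r + a) (hb : 0 ≤ b) :
    ∫⁻ x in Metric.closedBall 0 b, ENNReal.ofReal (‖x‖ ^ a) ∂(densityMeasure g) =
      (∫⁻ θ : Metric.sphere (0 : EuclideanSpace ℝ (Fin n)) 1, ENNReal.ofReal (g θ)
        ∂volume.toSphere) * ENNReal.ofReal (b ^ (n + r + a) / (n + r + a)) := by
  have : NeZero n := ⟨by lia⟩
  have : Nontrivial (EuclideanSpace ℝ (Fin n)) := by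
    apply Module.nontrivial_of_finrank_pos (R := ℝ)
    simp; lia
  rw [setLIntegral_densityMeasure hg (by fun_prop) measurableSet_closedBall,
    ← lintegral_indicator measurableSet_closedBall,
    lintegral_eq_lintegral_toSphere _ (Measurable.indicator (by fun_prop) measurableSet_closedBall),
    ← lintegral_mul_const _ (by fun_prop)]
  refine lintegral_congr fun θ => ?_
  rw [← setLIntegral_Ioc_rpow ha hb, ← lintegral_const_mul _ (by fun_prop),
    ← lintegral_indicator measurableSet_Ioc, ← lintegral_indicator measurableSet_Ioi]
  refine lintegral_congr fun s => ?_
  by_cases hs : 0 < s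
  swap
  · rw [indicator_of_notMem (by simpa using hs), indicator_of_notMem (by simp [hs])]
  rw [indicator_of_mem (by simpa using hs)]
  have hnorm : ‖s • (θ : EuclideanSpace ℝ (Fin n))‖ = s := by
    simp [norm_smul, abs_of_pos hs]
  have hiff : s • (θ : EuclideanSpace ℝ (Fin n)) ∈ Metric.closedBall 0 b ↔ s ∈ Ioc 0 b := by
    rw [mem_closedBall_zero_iff, hnorm, mem_Ioc]
    simp [hs]
  by_cases hs' : s ∈ Ioc 0 b
  · rw [indicator_of_mem hs', indicator_of_mem (hiff.2 hs'), hhom s hs, hnorm,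
      finrank_euclideanSpace, Fintype.card_fin, ENNReal.ofReal_mul (by positivity)]
    have e : s ^ (n + r + a - 1) = s ^ (n - 1) * s ^ r * s ^ a := by
      rw [← Real.rpow_natCast, ← Real.rpow_add hs, ← Real.rpow_add hs, Nat.cast_sub hn]
      congr 1
      push_cast
      ring
    rw [e, ENNReal.ofReal_mul (by positivity), ENNReal.ofReal_mul (by positivity)]
    ring
  · rw [indicator_of_notMem hs', indicator_of_notMem (by rwa [hiff]), mul_zero]

/-- The exponents `0` and `-1` of `‖x‖` give the same sphere integral of `g`, which is eliminated
between them; `1 < n + r` makes the radial integral converge. -/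
theorem setLIntegral_closedBall_inv_norm (hn : 1 ≤ n) (hg : Continuous g)
    (hhom : IsHomogeneousOfDegree r g) (hr : 1 < n + r) {b : ℝ} (hb : 0 ≤ b) :
    ∫⁻ x in Metric.closedBall 0 b, ENNReal.ofReal ‖x‖⁻¹ ∂(densityMeasure g) =
      densityMeasure g (unitBall n) *
        ENNReal.ofReal ((n + r) * b ^ (n + r - 1) / (n + r - 1)) := by
  have h1 := setLIntegral_closedBall_rpow_norm hn hg hhom (a := 0) (b := 1) (by linarith)
    zero_le_one
  have h2 := setLIntegral_closedBall_rpow_norm hn hg hhom (a := -1) (b := b) (by linarith) hb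
  simp only [Real.rpow_zero, ENNReal.ofReal_one, lintegral_one, Measure.restrict_apply_univ,
    add_zero, Real.one_rpow] at h1
  simp only [Real.rpow_neg_one] at h2
  rw [h2, unitBall, h1, mul_assoc, ← ENNReal.ofReal_mul (by positivity)]
  congr 2
  rw [← sub_eq_add_neg]
  field_simp

theorem ae_ne_zero_densityMeasure (hn : 1 ≤ n) : ∀ᵐ x ∂(densityMeasure g), x ≠ 0 := by
  have : Nontrivial (EuclideanSpace ℝ (Fin n)) := by
    apply Module.nontrivial_of_finrank_pos (R := ℝ)
    simp; lia
  refine (withDensity_absolutelyContinuous _ _).ae_le ?_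
  exact Measure.ae_ne volume 0

/-- Among all sets of given measure, centred balls maximize the integral of `‖x‖⁻¹`. -/
theorem setLIntegral_inv_norm_le_closedBall (hn : 1 ≤ n) (hg : Continuous g)
    {L : Set (EuclideanSpace ℝ (Fin n))} (hL : IsCompact L) {b : ℝ} (hb : 0 < b)
    (h : densityMeasure g L = densityMeasure g (Metric.closedBall 0 b)) :
    ∫⁻ x in L, ENNReal.ofReal ‖x‖⁻¹ ∂(densityMeasure g) ≤
      ∫⁻ x in Metric.closedBall 0 b, ENNReal.ofReal ‖x‖⁻¹ ∂(densityMeasure g) := by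
  set B : Set (EuclideanSpace ℝ (Fin n)) := Metric.closedBall 0 b with hB
  have hBm : MeasurableSet B := measurableSet_closedBall
  have hLm := hL.measurableSet
  -- Bathtub argument: `L \ B` and `B \ L` have equal mass, and `‖x‖⁻¹` is at most `b⁻¹` on the
  -- first and at least `b⁻¹` on the second.
  have hdiff : densityMeasure g (L \ B) = densityMeasure g (B \ L) := by
    have h1 := measure_inter_add_sdiff (μ := densityMeasure g) L hBm
    have h2 := measure_inter_add_sdiff (μ := densityMeasure g) B hLm
    rw [inter_comm, ← h, ← h1] at h2
    refine ((ENNReal.add_right_inj ?_).1 h2).symm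
    exact (measure_mono inter_subset_left |>.trans_lt (densityMeasure_lt_top hg hL)).ne
  have h1 : ∫⁻ x in L \ B, ENNReal.ofReal ‖x‖⁻¹ ∂(densityMeasure g) ≤
      ENNReal.ofReal b⁻¹ * densityMeasure g (L \ B) := by
    rw [← setLIntegral_const]
    refine setLIntegral_mono measurable_const fun x hx => ENNReal.ofReal_le_ofReal ?_
    have : b < ‖x‖ := by simpa [hB] using hx.2
    gcongr
  have h2 : ENNReal.ofReal b⁻¹ * densityMeasure g (B \ L) ≤
      ∫⁻ x in B \ L, ENNReal.ofReal ‖x‖⁻¹ ∂(densityMeasure g) := by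
    rw [← setLIntegral_const]
    refine setLIntegral_mono_ae (by fun_prop) ?_
    -- Since `‖0‖⁻¹ = 0`, the lower bound fails at the origin, which is a null set.
    filter_upwards [ae_ne_zero_densityMeasure hn] with x hx0 hx
    refine ENNReal.ofReal_le_ofReal ?_
    have h1 : ‖x‖ ≤ b := by simpa [hB] using hx.1
    have h2 : 0 < ‖x‖ := norm_pos_iff.2 hx0
    gcongr
  calc ∫⁻ x in L, ENNReal.ofReal ‖x‖⁻¹ ∂(densityMeasure g)
      = (∫⁻ x in L ∩ B, ENNReal.ofReal ‖x‖⁻¹ ∂(densityMeasure g)) +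
          ∫⁻ x in L \ B, ENNReal.ofReal ‖x‖⁻¹ ∂(densityMeasure g) :=
        (lintegral_inter_add_sdiff _ L hBm).symm
    _ ≤ (∫⁻ x in B ∩ L, ENNReal.ofReal ‖x‖⁻¹ ∂(densityMeasure g)) +
          ∫⁻ x in B \ L, ENNReal.ofReal ‖x‖⁻¹ ∂(densityMeasure g) := by
        rw [inter_comm]
        exact add_le_add_right (h1.trans (hdiff ▸ h2)) _
    _ = _ := lintegral_inter_add_sdiff _ B hLm

theorem measureReal_densityMeasure_smul (hg : Continuous g) (hhom : IsHomogeneousOfDegree r g)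
    {a : ℝ} (ha : 0 < a) {A : Set (EuclideanSpace ℝ (Fin n))} (hA : MeasurableSet A) :
    (densityMeasure g).real (a • A) = a ^ (n + r) * (densityMeasure g).real A := by
  rw [measureReal_def, densityMeasure_smul hg hhom ha hA, ENNReal.toReal_mul,
    ENNReal.toReal_ofReal (by positivity), measureReal_def]

theorem setLIntegral_inv_norm_le (hn : 1 ≤ n) (hg : Continuous g)
    (hhom : IsHomogeneousOfDegree r g) (hr : 1 < n + r)
    (hball : 0 < (densityMeasure g).real (unitBall n))
    {L : Set (EuclideanSpace ℝ (Fin n))} (hL : IsCompact L) :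
    ∫⁻ x in L, ENNReal.ofReal ‖x‖⁻¹ ∂(densityMeasure g) ≤
      ENNReal.ofReal ((densityMeasure g).real L ^ (1 - (n + r)⁻¹) *
        (densityMeasure g).real (unitBall n) ^ (n + r)⁻¹ / (1 - (n + r)⁻¹)) := by
  set D : ℝ := n + r with hD
  have hLtop := (densityMeasure_lt_top hg hL).ne
  have hcomp : IsCompact (unitBall n) := isCompact_closedBall _ _
  have hBtop := (densityMeasure_lt_top hg hcomp).ne
  have hDinv : D⁻¹ < 1 := inv_lt_one_of_one_lt₀ hr
  rcases eq_or_ne (densityMeasure g L) 0 with hL0 | hL0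
  · rw [setLIntegral_measure_zero _ _ hL0]
    exact zero_le
  set l := (densityMeasure g).real L with hl
  set β := (densityMeasure g).real (unitBall n) with hβ
  have hlpos : 0 < l := ENNReal.toReal_pos hL0 hLtop
  -- The radius of the centred ball with the measure of `L`; it is positive because null sets were
  -- treated above.
  set b : ℝ := (l / β) ^ D⁻¹ with hb
  have hbpos : 0 < b := by positivity
  have hbD : b ^ D = l / β := by
    rw [hb, ← Real.rpow_mul (by positivity), inv_mul_cancel₀ (by linarith), Real.rpow_one]
  have hball_eq : densityMeasure g L = densityMeasure g (Metric.closedBall 0 b) := by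
    have e : Metric.closedBall (0 : EuclideanSpace ℝ (Fin n)) b = b • unitBall n := by
      rw [unitBall, smul_unitClosedBall_of_nonneg hbpos.le]
    rw [e, ← ENNReal.toReal_eq_toReal_iff' hLtop
      (densityMeasure_lt_top hg (hcomp.smul b)).ne, ← measureReal_def, ← measureReal_def,
      measureReal_densityMeasure_smul hg hhom hbpos hcomp.measurableSet, ← hD, hbD]
    field_simp
    rfl
  refine (setLIntegral_inv_norm_le_closedBall hn hg hL hbpos hball_eq).trans (le_of_eq ?_)
  rw [setLIntegral_closedBall_inv_norm hn hg hhom hr hbpos.le, ← ENNReal.ofReal_toReal hBtop,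
    ← measureReal_def, ← hβ, ← ENNReal.ofReal_mul hball.le, ← hD]
  congr 1
  have e1 : b ^ (D - 1) = l ^ (1 - D⁻¹) / β ^ (1 - D⁻¹) := by
    rw [hb, ← Real.rpow_mul (by positivity), mul_sub, inv_mul_cancel₀ (by linarith), mul_one,
      Real.div_rpow hlpos.le hball.le]
  have e2 : β ^ (1 - D⁻¹) = β / β ^ D⁻¹ := by
    rw [Real.rpow_sub hball, Real.rpow_one]
  have hD1 : D - 1 ≠ 0 := by linarith
  have hD0 : D ≠ 0 := by linarith
  have hD2 : 1 - D⁻¹ = (D - 1) / D := by field_simp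
  have hβ1 : β ^ D⁻¹ ≠ 0 := by positivity
  rw [e1, e2]
  generalize l ^ (1 - D⁻¹) = X
  generalize β ^ D⁻¹ = Y at *
  rw [hD2]
  field_simp

end Ball

/-! ### The projection function and the isoperimetric inequality -/

section Projection

variable {n : ℕ} {g : EuclideanSpace ℝ (Fin n) → ℝ} {r : ℝ}
  {K : Set (EuclideanSpace ℝ (Fin n))}

theorem isGreatest_image_segment {E : Type*} [NormedAddCommGroup E] [NormedSpace ℝ E] (θ : E)
    (ℓ : E →L[ℝ] ℝ) : IsGreatest (ℓ '' segment ℝ (-θ) θ) |ℓ θ| := by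
  have h : ℓ '' segment ℝ (-θ) θ = segment ℝ (-(ℓ θ)) (ℓ θ) := by
    rw [← map_neg]
    exact image_segment ℝ (ℓ : E →ₗ[ℝ] ℝ).toAffineMap (-θ) θ
  rw [h, segment_eq_uIcc, uIcc, max_comm]
  exact isGreatest_Icc (inf_le_right.trans (le_max_left _ _))

theorem isGreatest_image_unitBall (ℓ : EuclideanSpace ℝ (Fin n) →L[ℝ] ℝ) :
    IsGreatest (ℓ '' unitBall n) ‖ℓ‖ := by
  refine ⟨?_, ?_⟩
  · obtain ⟨v, rfl⟩ := (InnerProductSpace.toDual ℝ (EuclideanSpace ℝ (Fin n))).surjective ℓ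
    rw [LinearIsometryEquiv.norm_map]
    rcases eq_or_ne v 0 with rfl | hv
    · exact ⟨0, by simp [unitBall], by simp⟩
    · have hv' : 0 < ‖v‖ := norm_pos_iff.2 hv
      refine ⟨‖v‖⁻¹ • v, ?_, ?_⟩
      · rw [unitBall, mem_closedBall_zero_iff, norm_smul, norm_inv, norm_norm,
          inv_mul_cancel₀ hv'.ne']
      · rw [InnerProductSpace.toDual_apply_apply, inner_smul_right, real_inner_self_eq_norm_sq]
        field_simp
  · rintro _ ⟨x, hx, rfl⟩
    rw [unitBall, mem_closedBall_zero_iff] at hx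
    calc ℓ x ≤ ‖ℓ x‖ := le_abs_self _
      _ ≤ ‖ℓ‖ * ‖x‖ := ℓ.le_opNorm x
      _ ≤ ‖ℓ‖ := mul_le_of_le_one_right (norm_nonneg _) hx

/-- From `t • K + ε • C = t • (K + (ε / t) • C)`, scaling by `t` gives `t ^ (n + r)` and rescaling
the increment gives `t⁻¹`. The first variation is a genuine limit, so the liminf equals it. -/
theorem mixedMeasure_smul_segment (hn : 1 ≤ n) (hg : Continuous g)
    (hhom : IsHomogeneousOfDegree r g) (hr : 0 ≤ r) (hK : Convex ℝ K) (hK0 : K ∈ 𝓝 0)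
    (hKb : IsCompact K) (θ : EuclideanSpace ℝ (Fin n)) {t : ℝ} (ht : 0 < t) :
    mixedMeasure (densityMeasure g) (t • K) (segment ℝ (-θ) θ) =
      t ^ (n + r - 1) *
        ((n + r) * ∫ x in K, |fderiv ℝ (gauge K) x θ| ∂(densityMeasure g)) := by
  have hCb : IsCompact (segment ℝ (-θ) θ) := by
    rw [segment_eq_image_lineMap]
    exact isCompact_Icc.image (by fun_prop)
  have h0 : (0 : EuclideanSpace ℝ (Fin n)) ∈ segment ℝ (-θ) θ :=
    ⟨1 / 2, 1 / 2, by norm_num, by norm_num, by norm_num, by simp⟩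
  have h1 := tendsto_densityMeasure_add_smul_sub_div hn hg hhom hr hK hK0 hKb
    (convex_segment _ _) hCb h0 (h := fun ℓ => |ℓ θ|) (isGreatest_image_segment θ)
  refine Tendsto.liminf_eq ?_
  have h2 : Tendsto (fun ε : ℝ => ε / t) (𝓝[>] 0) (𝓝[>] 0) := by
    refine tendsto_nhdsWithin_iff.2 ⟨?_, ?_⟩
    · have : Tendsto (fun ε : ℝ => ε / t) (𝓝 0) (𝓝 (0 / t)) := Continuous.tendsto (by fun_prop) _
      rw [zero_div] at this
      exact this.mono_left nhdsWithin_le_nhds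
    · filter_upwards [self_mem_nhdsWithin] with ε hε
      exact div_pos hε ht
  refine ((h1.comp h2).const_mul (t ^ (n + r - 1))).congr' ?_
  filter_upwards [self_mem_nhdsWithin] with ε hε
  have hε' : 0 < ε := hε
  have e : t • K + ε • segment ℝ (-θ) θ = t • (K + (ε / t) • segment ℝ (-θ) θ) := by
    rw [smul_add, smul_smul, mul_div_cancel₀ _ ht.ne']
  rw [e, measureReal_densityMeasure_smul hg hhom ht (hKb.add (hCb.smul _)).measurableSet,
    measureReal_densityMeasure_smul hg hhom ht hKb.measurableSet, Function.comp_apply,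
    Real.rpow_sub_one ht.ne']
  field_simp

/-- The integral of `t ^ (n + r - 1)` over `[0, 1]` cancels the factor `n + r` of the first
variation. -/
theorem muProjection_densityMeasure (hn : 1 ≤ n) (hg : Continuous g)
    (hhom : IsHomogeneousOfDegree r g) (hr : 0 ≤ r) (hK : Convex ℝ K) (hK0 : K ∈ 𝓝 0)
    (hKb : IsCompact K) (θ : EuclideanSpace ℝ (Fin n)) :
    muProjection (densityMeasure g) K θ =
      n / 2 * ∫ x in K, |fderiv ℝ (gauge K) x θ| ∂(densityMeasure g) := by
  have hn' : (1 : ℝ) ≤ n := by exact_mod_cast hn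
  rw [muProjection]
  congr 1
  rw [intervalIntegral.integral_of_le zero_le_one, setIntegral_congr_fun measurableSet_Ioc
    (fun t ht => mixedMeasure_smul_segment hn hg hhom hr hK hK0 hKb θ ht.1),
    integral_mul_const, ← intervalIntegral.integral_of_le zero_le_one,
    integral_rpow (Or.inl (by linarith)), Real.one_rpow, Real.zero_rpow (by linarith),
    sub_add_cancel, sub_zero, ← mul_assoc, one_div_mul_cancel (by linarith), one_mul]

/-- The isoperimetric inequality for measures with homogeneous log-concave density. -/
theorem rpow_mul_rpow_le_integral_norm_fderiv_gauge (hn : 1 ≤ n) (hg : Continuous g)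
    (hnonneg : ∀ x, 0 ≤ g x) (hhom : IsHomogeneousOfDegree r g) (hr : 0 ≤ r)
    (hlog : ∀ s t : ℝ, 0 < s → 0 < t → s + t = 1 → ∀ x y, g x ^ s * g y ^ t ≤ g (s • x + t • y))
    (hK : Convex ℝ K) (hK0 : K ∈ 𝓝 0) (hKb : IsCompact K)
    (hKpos : 0 < (densityMeasure g).real K) (hball : 0 < (densityMeasure g).real (unitBall n)) :
    (densityMeasure g).real K ^ (1 - (n + r)⁻¹) *
        (densityMeasure g).real (unitBall n) ^ (n + r)⁻¹ ≤
      ∫ x in K, ‖fderiv ℝ (gauge K) x‖ ∂(densityMeasure g) := by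
  have hn' : (1 : ℝ) ≤ n := by exact_mod_cast hn
  have hD : (1 : ℝ) ≤ n + r := by linarith
  have hcomp : IsCompact (unitBall n) := isCompact_closedBall _ _
  have h1 := tendsto_densityMeasure_add_smul_sub_div (C := unitBall n) hn hg hhom hr hK hK0 hKb
    (convex_closedBall _ _) hcomp (by simp [unitBall]) (h := fun ℓ => ‖ℓ‖)
    isGreatest_image_unitBall
  refine le_of_mul_le_mul_left ?_ (show 0 < n + r by linarith)
  -- Brunn-Minkowski followed by Bernoulli's inequality bounds every difference quotient from below,
  -- before the limit is taken.
  refine ge_of_tendsto h1 ?_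
  filter_upwards [self_mem_nhdsWithin] with ε hε
  have hε' : 0 < ε := hε
  have hεB := measureReal_densityMeasure_smul hg hhom hε' hcomp.measurableSet
  have hBM := densityMeasure_rpow_add_rpow_le hg hnonneg hhom (by linarith) hlog hKb
    (hcomp.smul ε) hKpos (by rw [hεB]; positivity)
  rw [hεB] at hBM
  set D : ℝ := n + r with hDdef
  set k := (densityMeasure g).real K
  set β := (densityMeasure g).real (unitBall n)
  set M := (densityMeasure g).real (K + ε • unitBall n)
  have hM : 0 ≤ M := measureReal_nonneg
  have hD0 : D ≠ 0 := by linarith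
  have e1 : (ε ^ D * β) ^ D⁻¹ = ε * β ^ D⁻¹ := by
    rw [Real.mul_rpow (by positivity) hball.le, ← Real.rpow_mul hε'.le, mul_inv_cancel₀ hD0,
      Real.rpow_one]
  rw [e1] at hBM
  have hbern := one_add_mul_self_le_rpow_one_add (s := ε * β ^ D⁻¹ / k ^ D⁻¹)
    (le_trans (by norm_num) (show (0 : ℝ) ≤ ε * β ^ D⁻¹ / k ^ D⁻¹ by positivity)) hD
  have hkD : (k ^ D⁻¹) ^ D = k := by
    rw [← Real.rpow_mul hKpos.le, inv_mul_cancel₀ hD0, Real.rpow_one]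
  have hMD : (M ^ D⁻¹) ^ D = M := by
    rw [← Real.rpow_mul hM, inv_mul_cancel₀ hD0, Real.rpow_one]
  have h2 : k * (1 + D * (ε * β ^ D⁻¹ / k ^ D⁻¹)) ≤ M := by
    calc k * (1 + D * (ε * β ^ D⁻¹ / k ^ D⁻¹))
        ≤ (k ^ D⁻¹) ^ D * (1 + ε * β ^ D⁻¹ / k ^ D⁻¹) ^ D := by
          rw [hkD]
          exact mul_le_mul_of_nonneg_left hbern hKpos.le
      _ = (k ^ D⁻¹ + ε * β ^ D⁻¹) ^ D := by
          rw [← Real.mul_rpow (by positivity) (by positivity)]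
          congr 1
          field_simp
      _ ≤ (M ^ D⁻¹) ^ D := Real.rpow_le_rpow (by positivity) hBM (by linarith)
      _ = M := hMD
  rw [le_div_iff₀ hε', Real.rpow_sub hKpos, Real.rpow_one]
  have h3 : D * (k / k ^ D⁻¹ * β ^ D⁻¹) * ε = k * (1 + D * (ε * β ^ D⁻¹ / k ^ D⁻¹)) - k := by
    field_simp
    ring
  linarith

end Projection

/-! ### Averages of sections and projections -/

/-- A finite iterated integral in `ℝ≥0∞` gives integrability on the product, so averages computed by
Tonelli carry over to Bochner integrals. -/
theorem integral_integral_eq_toReal_of_lintegral {X Y : Type*} [MeasurableSpace X]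
    [MeasurableSpace Y] {ν : Measure X} {η : Measure Y} [SFinite ν] [SFinite η] {f : X → Y → ℝ}
    (hf : Measurable (Function.uncurry f)) (hf0 : ∀ x y, 0 ≤ f x y) {J : ℝ≥0∞} (hJ : J ≠ ⊤)
    (h : ∫⁻ x, (∫⁻ y, ENNReal.ofReal (f x y) ∂η) ∂ν = J) :
    Integrable (fun x => ∫ y, f x y ∂η) ν ∧ ∫ x, (∫ y, f x y ∂η) ∂ν = J.toReal := by
  have h1 : ∫⁻ z, ENNReal.ofReal (Function.uncurry f z) ∂(ν.prod η) = J := by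
    rw [lintegral_prod _ hf.ennreal_ofReal.aemeasurable, ← h]
    rfl
  have h0 : 0 ≤ᵐ[ν.prod η] Function.uncurry f := Eventually.of_forall fun z => hf0 z.1 z.2
  have hint : Integrable (Function.uncurry f) (ν.prod η) := by
    refine ⟨hf.aestronglyMeasurable, ?_⟩
    rw [hasFiniteIntegral_iff_ofReal h0, h1]
    exact hJ.lt_top
  refine ⟨hint.integral_prod_left, ?_⟩
  rw [← h1, ← integral_eq_lintegral_of_nonneg_ae h0 hf.aestronglyMeasurable]
  exact (integral_prod _ hint).symm

section Section

variable {m : ℕ} {g : EuclideanSpace ℝ (Fin (m + 1)) → ℝ} {r : ℝ}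

theorem subspaceLebesgue_eq_volume {n : ℕ} (W : Submodule ℝ (EuclideanSpace ℝ (Fin n))) :
    subspaceLebesgue W = volume :=
  (stdOrthonormalBasis ℝ W).addHaar_eq_volume

theorem exists_linearIsometry_orthogonal {e : EuclideanSpace ℝ (Fin (m + 1))} (he : ‖e‖ = 1) :
    ∃ ι : EuclideanSpace ℝ (Fin m) →ₗᵢ[ℝ] EuclideanSpace ℝ (Fin (m + 1)),
      ∀ y, inner ℝ e (ι y) = 0 := by
  have : Fact (Module.finrank ℝ (EuclideanSpace ℝ (Fin (m + 1))) = m + 1) := ⟨by simp⟩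
  have he0 : e ≠ 0 := by
    rintro rfl
    simp at he
  let b := OrthonormalBasis.fromOrthogonalSpanSingleton (𝕜 := ℝ) m he0
  refine ⟨(Submodule.subtypeₗᵢ _).comp b.repr.symm.toLinearIsometry, fun y => ?_⟩
  exact Submodule.mem_orthogonal_singleton_iff_inner_right.1 (b.repr.symm y).2

/-- An isometric parametrization of `θ^⊥` carries Lebesgue measure of `ℝ^m` to that of the
hyperplane. -/
theorem sectionMeasure_eq_integral {θ : EuclideanSpace ℝ (Fin (m + 1))} (hθ : θ ≠ 0)
    {L : Set (EuclideanSpace ℝ (Fin (m + 1)))} (hL : MeasurableSet L)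
    (j : EuclideanSpace ℝ (Fin m) →ₗᵢ[ℝ] EuclideanSpace ℝ (Fin (m + 1)))
    (hj : ∀ y, inner ℝ θ (j y) = 0) :
    sectionMeasure g L θ = ∫ y, L.indicator g (j y) := by
  have : Fact (Module.finrank ℝ (EuclideanSpace ℝ (Fin (m + 1))) = m + 1) := ⟨by simp⟩
  let j' : EuclideanSpace ℝ (Fin m) →ₗᵢ[ℝ] (Submodule.span ℝ {θ})ᗮ :=
    ⟨j.toLinearMap.codRestrict _ fun y =>
      Submodule.mem_orthogonal_singleton_iff_inner_right.2 (hj y), fun y => j.norm_map y⟩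
  let T := j'.toLinearIsometryEquiv (by
    rw [Submodule.finrank_orthogonal_span_singleton (n := m) hθ, finrank_euclideanSpace,
      Fintype.card_fin])
  have hms : MeasurableSet {x : (Submodule.span ℝ {θ})ᗮ |
      (x : EuclideanSpace ℝ (Fin (m + 1))) ∈ L} := measurable_subtype_coe hL
  rw [sectionMeasure, subspaceLebesgue_eq_volume, ← integral_indicator hms,
    ← T.measurePreserving.integral_comp T.toHomeomorph.measurableEmbedding]
  rfl

/-- If `ι` parametrizes `e^⊥`, then `ρ U ∘ ι` parametrizes `(ρ U e)^⊥`. The averaged section is thus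
a multiple of `∫_L ‖x‖⁻¹ dμ`, to which the ball bound applies. -/
theorem IsRotationInvariant.integral_sectionMeasure_le {G : Type*} [MeasurableSpace G]
    {ν : Measure G} [IsProbabilityMeasure ν]
    {ρ : G → EuclideanSpace ℝ (Fin (m + 1)) ≃ₗᵢ[ℝ] EuclideanSpace ℝ (Fin (m + 1))}
    (h : IsRotationInvariant ν ρ) {e : EuclideanSpace ℝ (Fin (m + 1))} (he : ‖e‖ = 1)
    (hg : Continuous g) (hnonneg : ∀ x, 0 ≤ g x)
    (hhom : IsHomogeneousOfDegree r g) (hr : 1 < ((m + 1 : ℕ) : ℝ) + r)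
    (hball : 0 < (densityMeasure g).real (unitBall (m + 1)))
    {L : Set (EuclideanSpace ℝ (Fin (m + 1)))} (hL : IsCompact L) :
    Integrable (fun U => sectionMeasure g L (ρ U e)) ν ∧
    ∫ U, sectionMeasure g L (ρ U e) ∂ν ≤
      m * ballVolume m / ((m + 1) * ballVolume (m + 1)) *
      ((densityMeasure g).real L ^ (1 - (((m + 1 : ℕ) : ℝ) + r)⁻¹) *
        (densityMeasure g).real (unitBall (m + 1)) ^ (((m + 1 : ℕ) : ℝ) + r)⁻¹ /
        (1 - (((m + 1 : ℕ) : ℝ) + r)⁻¹)) := by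
  have hρe : ∀ U, ρ U e ≠ 0 := fun U => by
    rw [← norm_pos_iff, (ρ U).norm_map, he]
    exact one_pos
  obtain ⟨ι, hι⟩ := exists_linearIsometry_orthogonal he
  have hsec : ∀ U, sectionMeasure g L (ρ U e) = ∫ y, L.indicator g (ρ U (ι y)) := fun U =>
    sectionMeasure_eq_integral (hρe U) hL.measurableSet ((ρ U).toLinearIsometry.comp ι) fun y => by
      simp [hι]
  -- On the line the hyperplane is the origin, where homogeneity of positive degree forces `g 0 =
  -- 0`; both sides vanish.
  rcases Nat.eq_zero_or_pos m with rfl | hm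
  · have hr0 : 0 < r := by simpa using hr
    have hg0 : g 0 = 0 := by
      have h2 := hhom 2 two_pos 0
      rw [smul_zero] at h2
      have h3 : (1 : ℝ) < 2 ^ r := Real.one_lt_rpow one_lt_two hr0
      nlinarith [hnonneg 0]
    have hz : ∀ U, sectionMeasure g L (ρ U e) = 0 := by
      intro U
      rw [hsec]
      have : ∀ y, L.indicator g (ρ U (ι y)) = 0 := by
        intro y
        rw [Subsingleton.elim y 0, map_zero, map_zero]
        exact indicator_apply_eq_zero.2 fun _ => hg0
      simp [this]
    simp [hz]
  · set A := (densityMeasure g).real L ^ (1 - (((m + 1 : ℕ) : ℝ) + r)⁻¹) *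
        (densityMeasure g).real (unitBall (m + 1)) ^ (((m + 1 : ℕ) : ℝ) + r)⁻¹ /
        (1 - (((m + 1 : ℕ) : ℝ) + r)⁻¹) with hA
    have hA0 : 0 ≤ A := by
      have : (((m + 1 : ℕ) : ℝ) + r)⁻¹ < 1 := inv_lt_one_of_one_lt₀ hr
      have : 0 < 1 - (((m + 1 : ℕ) : ℝ) + r)⁻¹ := by linarith
      positivity
    have hind : Measurable (L.indicator g) := hg.measurable.indicator hL.measurableSet
    have key := h.lintegral_hyperplane hm ι hind.ennreal_ofReal
    have hI : ∫⁻ x, ENNReal.ofReal (L.indicator g x) * ENNReal.ofReal ‖x‖⁻¹ =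
        ∫⁻ x in L, ENNReal.ofReal ‖x‖⁻¹ ∂(densityMeasure g) := by
      rw [setLIntegral_densityMeasure hg (by fun_prop) hL.measurableSet,
        ← lintegral_indicator hL.measurableSet]
      refine lintegral_congr fun x => ?_
      by_cases hx : x ∈ L <;> simp [hx]
    have hbt := setLIntegral_inv_norm_le (by lia) hg hhom hr hball hL
    rw [← hA, ← hI] at hbt
    have hvol : ∀ k : ℕ, 1 ≤ k → volume (Metric.ball (0 : EuclideanSpace ℝ (Fin k)) 1) =
        ENNReal.ofReal (ballVolume k) := fun k hk => by
      rw [← volume_real_ball_zero_one hk, measureReal_def, ENNReal.ofReal_toReal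
        measure_ball_lt_top.ne]
    have hb1 := ballVolume_pos m
    have hb2 := ballVolume_pos (m + 1)
    have e1 : ((m : ℝ≥0∞) + 1) = ENNReal.ofReal (m + 1) := by
      rw [ENNReal.ofReal_add (by positivity) zero_le_one]
      simp
    rw [hvol _ hm, hvol _ (by lia), e1, ← ENNReal.ofReal_natCast m,
      ← ENNReal.ofReal_mul (by positivity), ← ENNReal.ofReal_mul (by positivity)] at key
    set J := ∫⁻ U, (∫⁻ y, ENNReal.ofReal (L.indicator g (ρ U (ι y)))) ∂ν with hJ
    have hc : 0 < ((m : ℝ) + 1) * ballVolume (m + 1) := by positivity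
    have hJle : J ≤ ENNReal.ofReal (m * ballVolume m / ((m + 1) * ballVolume (m + 1)) * A) := by
      rw [← ENNReal.mul_le_mul_iff_right (a := ENNReal.ofReal ((m + 1) * ballVolume (m + 1)))
        (by simpa using hc) ENNReal.ofReal_ne_top, key, ← ENNReal.ofReal_mul hc.le]
      refine (mul_le_mul_right hbt _).trans (le_of_eq ?_)
      rw [← ENNReal.ofReal_mul (by positivity)]
      congr 1
      field_simp
    have hJtop : J ≠ ⊤ := (hJle.trans_lt ENNReal.ofReal_lt_top).ne
    have hmeas : Measurable (Function.uncurry fun (U : G) (y : EuclideanSpace ℝ (Fin m)) =>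
        L.indicator g (ρ U (ι y))) :=
      hind.comp (h.measurable.comp
        (measurable_fst.prodMk (ι.continuous.measurable.comp measurable_snd)))
    obtain ⟨h1, h2⟩ := integral_integral_eq_toReal_of_lintegral hmeas
      (fun U y => indicator_nonneg (fun x _ => hnonneg x) _) hJtop hJ.symm
    simp only [hsec]
    refine ⟨h1, h2.trans_le ?_⟩
    exact ENNReal.toReal_le_of_le_ofReal (by positivity) hJle

/-- Tonelli reduces the claim to the average of a single linear functional over unit vectors; the
Lipschitz bound on the gauge gives integrability. -/
theorem IsRotationInvariant.integral_abs_fderiv_gauge {G : Type*} [MeasurableSpace G]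
    {ν : Measure G} [IsProbabilityMeasure ν]
    {ρ : G → EuclideanSpace ℝ (Fin (m + 1)) ≃ₗᵢ[ℝ] EuclideanSpace ℝ (Fin (m + 1))}
    (h : IsRotationInvariant ν ρ) {e : EuclideanSpace ℝ (Fin (m + 1))} (he : ‖e‖ = 1)
    (hg : Continuous g) {K : Set (EuclideanSpace ℝ (Fin (m + 1)))} (hK : Convex ℝ K)
    (hK0 : K ∈ 𝓝 0) (hKb : IsCompact K) :
    Integrable (fun U => ∫ x in K, |fderiv ℝ (gauge K) x (ρ U e)| ∂(densityMeasure g)) ν ∧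
    ∫ U, (∫ x in K, |fderiv ℝ (gauge K) x (ρ U e)| ∂(densityMeasure g)) ∂ν =
      2 * ballVolume m / ((m + 1) * ballVolume (m + 1)) *
        ∫ x in K, ‖fderiv ℝ (gauge K) x‖ ∂(densityMeasure g) := by
  have : Fact (densityMeasure g K < ⊤) := ⟨densityMeasure_lt_top hg hKb⟩
  have hfin : IsFiniteMeasure ((densityMeasure g).restrict K) := inferInstance
  have hb1 := ballVolume_pos m
  have hb2 := ballVolume_pos (m + 1)
  set c := 2 * ballVolume m / ((m + 1) * ballVolume (m + 1)) with hc
  have hc0 : 0 ≤ c := by positivity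
  obtain ⟨k, hk⟩ := hK.lipschitz_gauge hK0
  have hmd : Measurable fun x => fderiv ℝ (gauge K) x := measurable_fderiv ℝ _
  have hint : Integrable (fun x => c * ‖fderiv ℝ (gauge K) x‖) ((densityMeasure g).restrict K) := by
    refine (Integrable.of_bound (C := k) hmd.norm.aestronglyMeasurable
      (Eventually.of_forall fun x => ?_)).const_mul c
    rw [norm_norm]
    exact norm_fderiv_le_of_lipschitz ℝ hk
  have hmeas : Measurable (Function.uncurry fun (U : G) (x : EuclideanSpace ℝ (Fin (m + 1))) =>
      |fderiv ℝ (gauge K) x (ρ U e)|) := by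
    have h1 : Measurable fun z : G × EuclideanSpace ℝ (Fin (m + 1)) => ρ z.1 e :=
      (h.measurable.comp measurable_prodMk_right).comp measurable_fst
    have h2 : Measurable fun z : (EuclideanSpace ℝ (Fin (m + 1)) →L[ℝ] ℝ) ×
        EuclideanSpace ℝ (Fin (m + 1)) => |z.1 z.2| :=
      (continuous_fst.clm_apply continuous_snd).abs.measurable
    exact h2.comp ((hmd.comp measurable_snd).prodMk h1)
  have hJ : ∫⁻ U, (∫⁻ x in K, ENNReal.ofReal |fderiv ℝ (gauge K) x (ρ U e)| ∂(densityMeasure g)) ∂ν =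
      ENNReal.ofReal (c * ∫ x in K, ‖fderiv ℝ (gauge K) x‖ ∂(densityMeasure g)) := by
    rw [lintegral_lintegral_swap hmeas.ennreal_ofReal.aemeasurable, ← integral_const_mul,
      ofReal_integral_eq_lintegral_ofReal hint (Eventually.of_forall fun x => by positivity)]
    exact lintegral_congr fun x => h.lintegral_abs_apply he _
  obtain ⟨h1, h2⟩ := integral_integral_eq_toReal_of_lintegral hmeas (fun U x => abs_nonneg _)
    ENNReal.ofReal_ne_top hJ
  refine ⟨h1, h2.trans (ENNReal.toReal_ofReal ?_)⟩
  exact mul_nonneg hc0 (integral_nonneg fun x => norm_nonneg _)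

end Section

/-! ### Conclusion -/

/-- By homogeneity `g` is positive at `a • x₀` for all small `a > 0`, so it is positive on a
nonempty open subset of any neighbourhood of the origin. -/
theorem densityMeasure_real_pos {n : ℕ} {g : EuclideanSpace ℝ (Fin n) → ℝ} {r : ℝ}
    (hg : Continuous g) (hnonneg : ∀ x, 0 ≤ g x) (hhom : IsHomogeneousOfDegree r g)
    {x₀ : EuclideanSpace ℝ (Fin n)} (hx₀ : g x₀ ≠ 0) {A : Set (EuclideanSpace ℝ (Fin n))}
    (hA : IsCompact A) (hA0 : A ∈ 𝓝 0) : 0 < (densityMeasure g).real A := by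
  refine ENNReal.toReal_pos ?_ (densityMeasure_lt_top hg hA).ne
  have hlim : Tendsto (fun a : ℝ => a • x₀) (𝓝[>] 0) (𝓝 0) := by
    have : Tendsto (fun a : ℝ => a • x₀) (𝓝 0) (𝓝 ((0 : ℝ) • x₀)) := Continuous.tendsto (by fun_prop) _
    rw [zero_smul] at this
    exact this.mono_left nhdsWithin_le_nhds
  obtain ⟨a, ha, ha0⟩ := ((hlim.eventually (interior_mem_nhds.2 hA0)).and self_mem_nhdsWithin).exists
  have ha0' : 0 < a := ha0
  have hpos : 0 < g (a • x₀) := by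
    rw [hhom a ha0']
    exact mul_pos (by positivity) ((hnonneg _).lt_of_ne' hx₀)
  intro h0
  have hopen : IsOpen (interior A ∩ {x | 0 < g x}) :=
    isOpen_interior.inter (isOpen_lt continuous_const hg)
  rw [densityMeasure_apply, setLIntegral_eq_zero_iff hA.measurableSet (by fun_prop)] at h0
  refine (hopen.measure_pos volume ⟨_, ha, hpos⟩).ne' (measure_mono_null ?_ h0)
  intro x hx
  simpa using ⟨interior_subset hx.1, hx.2⟩

theorem theorem1p4 (n : ℕ) (hn : 1 ≤ n) (p : ℝ≥0∞) (hp : 0 < p)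
    (hnp : n ≠ 1 ∨ p ≠ ⊤)
    (g : EuclideanSpace ℝ (Fin n) → ℝ) (hg_nonneg : ∀ x, 0 ≤ g x) (hg_cont : Continuous g)
    (hg_conc : IsPConcave p g) (hg_hom : IsHomogeneousOfDegree (1 / p).toReal g)
    (μ : Measure (EuclideanSpace ℝ (Fin n)))
    (hμ : μ = volume.withDensity (fun x => ENNReal.ofReal (g x)))
    (K L : Set (EuclideanSpace ℝ (Fin n)))
    (hK : IsConvexBody K) (hK_symm : IsOriginSymmetric K) (hL : IsStarBody L)
    (ε : ℝ)
    (hKL : ∀ θ : EuclideanSpace ℝ (Fin n), ‖θ‖ = 1 →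
      muProjection μ K θ ≤ sectionMeasure g L θ + ε)
    (q : ℝ) (hq : q = 1 / ((n : ℝ) + (1 / p).toReal)) :
    μ.real K ^ (1 - q) ≤
      ((1 - 1 / (n : ℝ)) / (1 - q)) * μ.real L ^ (1 - q)
        + ballVolume n / (μ.real (unitBall n) ^ q * ballVolume (n - 1)) * ε := by
  obtain rfl : μ = densityMeasure g := hμ
  obtain ⟨m, rfl⟩ : ∃ m, n = m + 1 := ⟨n - 1, by lia⟩
  set r := (1 / p).toReal with hrdef
  have hr : 0 ≤ r := ENNReal.toReal_nonneg
  -- The exclusion of `n = 1`, `p = ∞` enters here: it is the only case with `n + r = 1`, that is,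
  -- `q = 1`.
  have hD : 1 < ((m + 1 : ℕ) : ℝ) + r := by
    rcases Nat.eq_zero_or_pos m with rfl | hm
    · have hp' : p ≠ ⊤ := by simpa using hnp
      have : 0 < r := ENNReal.toReal_pos (by simpa using hp') (by simpa using hp.ne')
      simpa using this
    · have : (1 : ℝ) ≤ m := by exact_mod_cast hm
      push_cast
      linarith
  rw [one_div] at hq
  have hq1 : q < 1 := hq ▸ inv_lt_one_of_one_lt₀ hD
  have hq0 : 0 < q := hq ▸ inv_pos.2 (by linarith)
  -- For `μ = 0` both exponents are positive, so the powers vanish, and division by zero makes the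
  -- last term `0`.
  by_cases hg0 : ∀ x, g x = 0
  · have hz : ∀ A, (densityMeasure g).real A = 0 := by
      intro A
      rw [measureReal_def, densityMeasure_apply]
      simp [hg0]
    simp [hz, Real.zero_rpow hq0.ne', Real.zero_rpow (sub_pos.2 hq1).ne']
  push Not at hg0
  obtain ⟨x₀, hx₀⟩ := hg0
  have hK0 := IsConvexBody.mem_nhds_zero hK hK_symm
  have hKpos := densityMeasure_real_pos hg_cont hg_nonneg hg_hom hx₀ hK.isCompact hK0
  have hball : 0 < (densityMeasure g).real (unitBall (m + 1)) :=
    densityMeasure_real_pos hg_cont hg_nonneg hg_hom hx₀ (isCompact_closedBall _ _)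
      (Metric.closedBall_mem_nhds _ one_pos)
  obtain ⟨G, _, ν, ρ, hν, hρ⟩ := exists_isRotationInvariant (m + 1)
  obtain ⟨e, he⟩ : ∃ e : EuclideanSpace ℝ (Fin (m + 1)), ‖e‖ = 1 :=
    ⟨EuclideanSpace.single 0 1, by simp⟩
  obtain ⟨hPi, hP⟩ := hρ.integral_abs_fderiv_gauge he hg_cont hK.convex hK0 hK.isCompact
  obtain ⟨hSi, hS⟩ := hρ.integral_sectionMeasure_le he hg_cont hg_nonneg hg_hom hD hball
    hL.isCompact
  have hiso := rpow_mul_rpow_le_integral_norm_fderiv_gauge hn hg_cont hg_nonneg hg_hom hr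
    (fun s t hs ht hst => hg_conc.geom_mean_le hp hg_nonneg hs ht hst) hK.convex hK0 hK.isCompact
    hKpos hball
  rw [← hq] at hS hiso
  -- The hypothesis at `θ = ρ U e`, averaged over `U`.
  have hmono : ∫ U, ((m + 1 : ℕ) : ℝ) / 2 *
      (∫ x in K, |fderiv ℝ (gauge K) x (ρ U e)| ∂(densityMeasure g)) ∂ν ≤
      ∫ U, (sectionMeasure g L (ρ U e) + ε) ∂ν := by
    refine integral_mono (hPi.const_mul _) (hSi.add (integrable_const ε)) fun U => ?_
    have := hKL (ρ U e) (by rw [(ρ U).norm_map, he])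
    rwa [muProjection_densityMeasure hn hg_cont hg_hom hr hK.convex hK0 hK.isCompact] at this
  rw [integral_const_mul, hP, integral_add hSi (integrable_const ε)] at hmono
  simp only [integral_const, probReal_univ, one_smul] at hmono
  have hb1 := ballVolume_pos m
  have hb2 := ballVolume_pos (m + 1)
  have hβ : 0 < (densityMeasure g).real (unitBall (m + 1)) ^ q := by positivity
  have h1q : 0 < 1 - q := sub_pos.2 hq1
  rw [Nat.add_sub_cancel]
  generalize (densityMeasure g).real K ^ (1 - q) = k at *
  generalize (densityMeasure g).real L ^ (1 - q) = l at *
  generalize (densityMeasure g).real (unitBall (m + 1)) ^ q = β at *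
  generalize ∫ x in K, ‖fderiv ℝ (gauge K) x‖ ∂(densityMeasure g) = I at *
  generalize ballVolume m = a at *
  generalize ballVolume (m + 1) = b at *
  have h1 : a / b * (k * β) ≤ m * a / ((m + 1) * b) * (l * β / (1 - q)) + ε := by
    calc a / b * (k * β) ≤ a / b * I := by gcongr
      _ = ((m + 1 : ℕ) : ℝ) / 2 * (2 * a / ((m + 1) * b) * I) := by
          push_cast
          field_simp
      _ ≤ _ := by linarith
  have h2 : k = b / (a * β) * (a / b * (k * β)) := by field_simp
  rw [h2]
  refine (mul_le_mul_of_nonneg_left h1 (by positivity)).trans (le_of_eq ?_)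
  push_cast
  field_simp
  ring
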